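/- **Setting and notation.** Fix $T\in\mathbb N$; $\langle\cdot,\cdot\rangle,\|\cdot\|$ are Euclidean on $\mathbb R^T$, $\|\cdot\|_2$ is the norm of $L^2([0,1],\mathbb R^T)$ (Lebesgue measure), $d$ and $d_H$ are the point-to-set and Hausdorff distances (values in $[0,\infty]$, $d(x,\emptyset)=\infty$). For $C\subset\mathbb R^T$ let $\mathrm{rbd}\,C$ be the boundary of $C$ relative to its linear span $\mathrm{span}\,C$. For $\varphi$ with domain $C$, $\partial\varphi(x)=\{g:\varphi(z)\ge\varphi(x)+\langle g,z-x\rangle\ \forall z\in C\}$; $\partial_1$ is the subdifferential in the first variable, the second being fixed. For $M>0$ put $\mathcal M=[0,M+1]^T$. *Finite game* $\mathcal G=(I,(\mathcal X_i),(f_i))$: finitely many players $i$, nonempty convex compact $\mathcal X_i\subset\mathbb R^T$, costs $f_i(x,Y)$ defined on a set $\mathrm{dom}_i\subset\mathbb R^T\times\mathbb R^T$ containing all $(x_i,\sum_jx_j)$ with $x\in\prod_j\mathcal X_j$. Put $\hat f_i(x,W)=f_i(x,x+W)$. For every $x\in\prod_j\mathcal X_j$, $\hat f_i(\cdot,\sum_{j\ne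 i}x_j)$ is convex and continuous on $\mathcal X_i$, and for each $z\in\mathcal X_i$, $\hat f_i(z,\cdot)$ is continuous on $\{\sum_{j\neq i}x_j\}$. For $A\subset\mathbb R^T$ let $\mathcal X(A)=\{x\in\prod_i\mathcal X_i:\sum_ix_i\in A\}$. A *VNE* of $\mathcal G(A)$ is $\hat x\in\mathcal X(A)$ such that there are $g_i\in\partial_1\hat f_i(\hat x_i,\sum_{j\ne i}\hat x_j)$ with $\sum_i\langle g_i,x_i-\hat x_i\rangle\ge0$ for all $x\in\mathcal X(A)$. *Nonatomic game* $G=((\mathcal X_\theta),(f_\theta))_{\theta\in[0,1]}$: let $\mathcal X$ be the set of $x\in L^2([0,1],\mathbb R^T)$ with $x_\theta\in\mathcal X_\theta$ a.e., $\mathcal X(A)=\{x\in\mathcal X:\int x\in A\}$, $\overline{\mathcal X}=\{\int x:x\in\mathcal X\}$, and $H(x)=\{g\in L^2([0,1],\mathbb R^T):g_\theta\in\partial_1f_\theta(x_\theta,\int x)\text{ a.e.}\}$. A *VWE* of $G(A)$ is $x^*\in\mathcal X(A)$ for which some $g\in H(x^*)$ satisfies $\int\langle g_\theta,x_\theta-x^*_\theta\rangle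 d\theta\ge0$ for all $x\in\mathcal X(A)$. $G$ is *strongly monotone* with modulus $\alpha>0$ (resp. *aggregatively strongly monotone* with modulus $\beta>0$) if for all $x,y\in L^2([0,1],\mathcal M)$, $g\in H(x)$, $h\in H(y)$, $\int\langle g_\theta-h_\theta,x_\theta-y_\theta\rangle d\theta$ is at least $\alpha\|x-y\|_2^2$ (resp. $\beta\|\int x-\int y\|^2$). **Assumptions on $G$** (with constants $M,B_f>0$). (a) Each $\mathcal X_\theta$ is nonempty, convex, compact, contained in $\mathcal M$ and in the closed ball of radius $M$ about $0$; the graph of $\theta\mapsto\mathcal X_\theta$ is Borel. (b) For a neighbourhood $\mathcal M'$ of $\mathcal M$, each $f_\theta(\cdot,Y)$ with $Y\in\mathcal M$ is defined, continuous and convex on $\mathcal M'$ (the domain for $\partial_1$); $f_\theta$ is bounded on $\mathcal M^2$; $(\theta,x)\mapsto f_\theta(x,Y)$ is measurable on the graph of $\mathcal X$; $\|g\|\le B_f$ for all $g\in\partial_1f_\theta(x,Y)$, $x,Y\in\mathcal M$, $\theta\in[0,1]$. (c) For $Y\in\overline{\mathcal X}$ and $x\in\mathcal X$ with $x_\theta\in\arg\min_{\mathcal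 X_\theta}f_\theta(\cdot,Y)$ for all $\theta$, the correspondence $\theta\mapsto\{g\in\partial_1f_\theta(x_\theta,Y):\langle g,y-x_\theta\rangle\ge0\ \forall y\in\mathcal X_\theta\}$ is measurable. (d) $f_\theta(x,\cdot)$ is continuous on $\mathcal M$ for $x\in\mathcal M$. (e) There are $\eta>0$ and $\bar x\in\mathcal X$ with $d(\bar x_\theta,\mathrm{rbd}\,\mathcal X_\theta)>\eta$ for a.e. $\theta$. **Atomic approximating sequence (AAS).** A sequence of finite games $\mathcal G^\nu=(I^\nu,(\mathcal X_i^\nu),(f_i^\nu))$ with, for every $\nu$, a partition of $[0,1]$ into a null set $\Theta_0^\nu$ and measurable sets $\Theta_i^\nu$, $i\in I^\nu$, of measure $\mu_i^\nu>0$, such that $\mathcal X_i^\nu\subset\mathbb R_+^T$, $f_i^\nu$ is defined on $\mu_i^\nu\mathcal M\times\mathcal M$, $\mathrm{span}\,\mathcal X_i^\nu=\mathrm{span}\,\mathcal X_\theta$ for all $\theta\in\Theta_i^\nu$, and as $\nu\to\infty$ the following tend to $0$: $$\bar d^\nu=\max_i\sup_{\theta\in\Theta_i^\nu}d_H\big(\mathcal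 X_\theta,\tfrac1{\mu_i^\nu}\mathcal X_i^\nu\big),\qquad \bar\lambda^\nu=\max_i\sup_{(x,Y)\in\mathcal M^2}\ \sup_{g\in\partial_1\hat f_i^\nu(\mu_i^\nu x,\,Y-\mu_i^\nu x)}d\big(g,\partial_1f_i^\nu(\mu_i^\nu x,Y)\big),$$ $$\bar\delta^\nu=\max_i\sup_{\theta\in\Theta_i^\nu}\sup_{(x,Y)\in\mathcal M^2}d_H\big(\partial_1f_i^\nu(\mu_i^\nu x,Y),\partial_1f_\theta(x,Y)\big).$$ With constraints, $(\mathcal G^\nu(A^\nu))$ is an AAS of $G(A)$ if moreover the $A^\nu$ are convex and compact, $\mathcal X^\nu(A^\nu)\neq\emptyset$, $\mathrm{span}\,A^\nu=\mathrm{span}\,A$, and $D^\nu=d_H(A^\nu,A)\to0$. Put $\psi^\nu(x)_\theta=x_i/\mu_i^\nu$ for $\theta\in\Theta_i^\nu$. **Theorem (Convergence of VNE to VWE).** Let $G$ satisfy (a)–(e). *With aggregative constraints.* Let $A\subset\mathbb R^T$ be convex and compact, such that some point of $A\cap\overline{\mathcal X}$ lies neither in $\mathrm{rbd}\,A$ nor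 in $\mathrm{rbd}\,\overline{\mathcal X}$. Then there are constants $\rho,\bar\rho>0$, depending only on $G$ (with $M,B_f$) and $A$, such that with $K_A=\frac{M+1}{\min\{\rho,\bar\rho\}}$ the following holds for every AAS $(\mathcal G^\nu(A^\nu))_\nu$ of $G(A)$, every VWE $x^*$ of $G(A)$ with aggregate $X^*=\int x^*$, and all VNE $\hat x^\nu$ of $\mathcal G^\nu(A^\nu)$ with aggregates $\hat X^\nu=\sum_i\hat x_i^\nu$. (1) If $G$ is aggregatively strongly monotone with modulus $\beta$, then $\hat X^\nu\to X^*$, and for all $\nu$ with $\max(\bar d^\nu,D^\nu)<\min\{\rho,\bar\rho\}$, $$\|\hat X^\nu-X^*\|^2\le\frac1\beta\Big((3B_f+1)K_A\max(D^\nu,\bar d^\nu)+(2M+1)(\bar\delta^\nu+\bar\lambda^\nu)\Big).$$ (2) If $G$ is strongly monotone with modulus $\alpha$, then $\psi^\nu(\hat x^\nu)\to x^*$ in $L^2$, and for all $\nu$ with $\max(\bar d^\nu,D^\nu)<\min\{\rho,\bar\rho\}$, $$\|\psi^\nu(\hat x^\nu)-x^*\|_2^2\le\frac1\alpha\Big((3B_f+1)K_A\max(D^\nu,\bar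 d^\nu)+(2M+1)(\bar\delta^\nu+\bar\lambda^\nu)\Big).$$ *Without aggregative constraints* ($A=A^\nu=\mathbb R^T$, only the conditions on $(\mathcal G^\nu)$ being required), there is $\rho>0$, depending only on $G$ (with $M,B_f$), such that the conclusions (1) and (2) hold with $K_A$ replaced by $1$ and $D^\nu$ by $0$, the bounds being valid for all $\nu$ with $\bar d^\nu<\rho$. -/

import Mathlib

open MeasureTheory Filter Set
open scoped ENNReal Pointwise Topology

noncomputable section

namespace AggGame

/-- The Euclidean space `ℝ^T`. -/
abbrev E (T : ℕ) := EuclideanSpace ℝ (Fin T)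

/-- The player space `Θ = [0,1]` with Lebesgue measure. -/
def leb : Measure ℝ := volume.restrict (Icc 0 1)

/-- The subdifferential at `x` of a function `φ` with domain `C`. -/
def subdiff {T : ℕ} (C : Set (E T)) (φ : E T → ℝ) (x : E T) : Set (E T) :=
  {g | ∀ z ∈ C, φ x + inner ℝ g (z - x) ≤ φ z}

/-- The relative boundary of `C`: its boundary in its linear span. -/
def rbd {T : ℕ} (C : Set (E T)) : Set (E T) :=
  (fun v : Submodule.span ℝ C => (v : E T)) ''
    frontier ((fun v : Submodule.span ℝ C => (v : E T)) ⁻¹' C)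

/-- The box `𝓜 = [0, M+1]^T`. -/
def box (T : ℕ) (M : ℝ) : Set (E T) := {x | ∀ t, 0 ≤ x t ∧ x t ≤ M + 1}

/-! ### Finite-player aggregative games -/

/-- A finite-player aggregative game. The cost `f i x Y` of player `i` is a function of her own
action `x` and of the aggregate `Y`; only its values on `dom i` (the set of pairs `(x, Y)` where it
is defined) matter. -/
structure FiniteGame (T : ℕ) where
  /-- number of players -/
  I : ℕ
  /-- action sets -/
  X : Fin I → Set (E T)
  /-- domains of the cost functions -/
  dom : Fin I → Set (E T × E T)
  /-- cost functions -/
  f : Fin I → E T → E T → ℝ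

namespace FiniteGame

variable {T : ℕ} (G : FiniteGame T)

/-- `𝒳(A)`: feasible profiles whose aggregate lies in `A`. -/
def profiles (A : Set (E T)) : Set (Fin G.I → E T) :=
  {x | (∀ i, x i ∈ G.X i) ∧ ∑ i, x i ∈ A}

/-- Aggregate of the players other than `i`. -/
def others (x : Fin G.I → E T) (i : Fin G.I) : E T := ∑ j ∈ Finset.univ.erase i, x j

/-- `∂₁ f_i (x, Y)`: the aggregate is held fixed. -/
def sub (i : Fin G.I) (x Y : E T) : Set (E T) :=
  subdiff {z | (z, Y) ∈ G.dom i} (fun z => G.f i z Y) x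

/-- `f̂_i (z, W) = f_i (z, z + W)`. -/
def fhat (i : Fin G.I) (z W : E T) : ℝ := G.f i z (z + W)

/-- `∂₁ f̂_i (x, W)`: the aggregate `W` of the other players is held fixed. -/
def subHat (i : Fin G.I) (x W : E T) : Set (E T) :=
  subdiff {z | (z, z + W) ∈ G.dom i} (fun z => G.fhat i z W) x

/-- Variational Nash equilibrium of `G(A)`. -/
def IsVNE (A : Set (E T)) (x : Fin G.I → E T) : Prop :=
  x ∈ G.profiles A ∧
    ∃ g : Fin G.I → E T, (∀ i, g i ∈ G.subHat i (x i) (G.others x i)) ∧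
      ∀ y ∈ G.profiles A, 0 ≤ ∑ i, inner ℝ (g i) (y i - x i)

/-- Standing assumptions on a finite-player game: convex compact action sets, convex costs. -/
structure Standing : Prop where
  nonempty : ∀ i, (G.X i).Nonempty
  convex : ∀ i, Convex ℝ (G.X i)
  compact : ∀ i, IsCompact (G.X i)
  dom_feasible : ∀ x : Fin G.I → E T, (∀ i, x i ∈ G.X i) → ∀ i, (x i, ∑ j, x j) ∈ G.dom i
  cost_convex : ∀ x : Fin G.I → E T, (∀ i, x i ∈ G.X i) → ∀ i,
    ConvexOn ℝ (G.X i) (fun z => G.fhat i z (G.others x i))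
  cost_continuous_own : ∀ x : Fin G.I → E T, (∀ i, x i ∈ G.X i) → ∀ i,
    ContinuousOn (fun z => G.fhat i z (G.others x i)) (G.X i)
  cost_continuous_others : ∀ i, ∀ z ∈ G.X i,
    ContinuousOn (fun W => G.fhat i z W) {W | ∃ x, (∀ j, x j ∈ G.X j) ∧ W = G.others x i}

end FiniteGame

/-! ### Nonatomic aggregative games -/

/-- A nonatomic aggregative game on `Θ = [0,1]`. The cost `f θ x Y` of player `θ` is defined for own
actions `x` in the set `N` (the neighbourhood `𝓜'` of the box `𝓜`). -/
structure NonatomicGame (T : ℕ) where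
  /-- action sets -/
  X : ℝ → Set (E T)
  /-- domain of the cost functions in the own action -/
  N : Set (E T)
  /-- cost functions -/
  f : ℝ → E T → E T → ℝ

namespace NonatomicGame

variable {T : ℕ} (G : NonatomicGame T)

/-- `𝒳(A)`: square integrable profiles, feasible a.e., whose aggregate lies in `A`. -/
def profiles (A : Set (E T)) : Set (ℝ → E T) :=
  {x | MemLp x 2 leb ∧ (∀ᵐ θ ∂leb, x θ ∈ G.X θ) ∧ ∫ θ, x θ ∂leb ∈ A}

/-- The set of feasible aggregate actions. -/
def aggregates : Set (E T) := {Y | ∃ x ∈ G.profiles univ, ∫ θ, x θ ∂leb = Y}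

/-- `∂₁ f_θ (x, Y)`. -/
def sub (θ : ℝ) (x Y : E T) : Set (E T) := subdiff G.N (fun z => G.f θ z Y) x

/-- `H(x)`: square integrable selections of subgradients. -/
def H (x : ℝ → E T) : Set (ℝ → E T) :=
  {g | MemLp g 2 leb ∧ ∀ᵐ θ ∂leb, g θ ∈ G.sub θ (x θ) (∫ ξ, x ξ ∂leb)}

/-- Variational Wardrop equilibrium of `G(A)`. -/
def IsVWE (A : Set (E T)) (x : ℝ → E T) : Prop :=
  x ∈ G.profiles A ∧
    ∃ g ∈ G.H x, ∀ y ∈ G.profiles A, 0 ≤ ∫ θ, inner ℝ (g θ) (y θ - x θ) ∂leb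

/-- Elements of `L²([0,1], 𝓜)`. -/
def boxProfiles (T : ℕ) (M : ℝ) : Set (ℝ → E T) :=
  {x | MemLp x 2 leb ∧ ∀ᵐ θ ∂leb, x θ ∈ box T M}

/-- Strong monotonicity with modulus `α`. -/
def StronglyMonotone (M α : ℝ) : Prop :=
  ∀ x ∈ boxProfiles T M, ∀ y ∈ boxProfiles T M, ∀ g ∈ G.H x, ∀ h ∈ G.H y,
    α * (eLpNorm (x - y) 2 leb).toReal ^ 2 ≤ ∫ θ, inner ℝ (g θ - h θ) (x θ - y θ) ∂leb

/-- Aggregative strong monotonicity with modulus `β`. -/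
def AggStronglyMonotone (M β : ℝ) : Prop :=
  ∀ x ∈ boxProfiles T M, ∀ y ∈ boxProfiles T M, ∀ g ∈ G.H x, ∀ h ∈ G.H y,
    β * ‖(∫ θ, x θ ∂leb) - ∫ θ, y θ ∂leb‖ ^ 2 ≤ ∫ θ, inner ℝ (g θ - h θ) (x θ - y θ) ∂leb

/-- The best replies to the aggregate `Y`. -/
def bestReplies (Y : E T) : Set (ℝ → E T) :=
  {x | x ∈ G.profiles univ ∧
    ∀ θ ∈ Icc (0 : ℝ) 1, x θ ∈ G.X θ ∧ ∀ z ∈ G.X θ, G.f θ (x θ) Y ≤ G.f θ z Y}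

/-- Subgradients certifying that `x θ` is optimal for player `θ` against the aggregate `Y`. -/
def optimalSub (x : ℝ → E T) (Y : E T) (θ : ℝ) : Set (E T) :=
  {g | g ∈ G.sub θ (x θ) Y ∧ ∀ y ∈ G.X θ, 0 ≤ inner ℝ g (y - x θ)}

/-- Standing assumptions on a nonatomic game, with the constants `M` and `B = B_f`. -/
structure Standing (M B : ℝ) : Prop where
  M_pos : 0 < M
  B_pos : 0 < B
  -- action sets
  nonempty : ∀ θ ∈ Icc (0 : ℝ) 1, (G.X θ).Nonempty
  convex : ∀ θ ∈ Icc (0 : ℝ) 1, Convex ℝ (G.X θ)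
  compact : ∀ θ ∈ Icc (0 : ℝ) 1, IsCompact (G.X θ)
  graph_measurable : MeasurableSet {p : ℝ × E T | p.1 ∈ Icc (0 : ℝ) 1 ∧ p.2 ∈ G.X p.1}
  subset_ball : ∀ θ ∈ Icc (0 : ℝ) 1, G.X θ ⊆ Metric.closedBall 0 M
  subset_box : ∀ θ ∈ Icc (0 : ℝ) 1, G.X θ ⊆ box T M
  -- cost functions
  nhds_box : G.N ∈ 𝓝ˢ (box T M)
  cost_bounded : ∀ θ ∈ Icc (0 : ℝ) 1, ∃ C, ∀ x ∈ box T M, ∀ Y ∈ box T M, |G.f θ x Y| ≤ C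
  cost_measurable : ∀ Y ∈ box T M,
    Measurable (fun p : {p : ℝ × E T | p.1 ∈ Icc (0 : ℝ) 1 ∧ p.2 ∈ G.X p.1} =>
      G.f p.1.1 p.1.2 Y)
  cost_continuous : ∀ Y ∈ box T M, ∀ θ ∈ Icc (0 : ℝ) 1,
    ContinuousOn (fun x => G.f θ x Y) G.N
  cost_convex : ∀ Y ∈ box T M, ∀ θ ∈ Icc (0 : ℝ) 1, ConvexOn ℝ G.N (fun x => G.f θ x Y)
  sub_bounded : ∀ θ ∈ Icc (0 : ℝ) 1, ∀ x ∈ box T M, ∀ Y ∈ box T M, ∀ g ∈ G.sub θ x Y, ‖g‖ ≤ B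
  -- measurability of the correspondence of optimal subgradients
  optimalSub_measurable : ∀ Y ∈ G.aggregates, ∀ x ∈ G.bestReplies Y, ∀ F : Set (E T), IsClosed F →
    NullMeasurableSet {θ | θ ∈ Icc (0 : ℝ) 1 ∧ (G.optimalSub x Y θ ∩ F).Nonempty} volume
  -- continuity of the costs in the aggregate
  cost_continuous_agg : ∀ θ ∈ Icc (0 : ℝ) 1, ∀ x ∈ box T M,
    ContinuousOn (fun Y => G.f θ x Y) (box T M)
  -- the relative interiors of the action sets do not vanish
  interior_profile : ∃ η : ℝ, 0 < η ∧ ∃ x ∈ G.profiles univ,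
    ∀ᵐ θ ∂leb, ENNReal.ofReal η < Metric.infEDist (x θ) (rbd (G.X θ))

end NonatomicGame

/-! ### Atomic approximating sequences -/

section Approx

variable {T : ℕ} (G : NonatomicGame T) (Γ : FiniteGame T) (Θ : Fin Γ.I → Set ℝ)

/-- `μ_i`, the Lebesgue measure of the cell `Θ_i`. -/
def mass (i : Fin Γ.I) : ℝ := (volume (Θ i)).toReal

/-- `d̄ = max_i sup_{θ ∈ Θ_i} d_H (X_θ, X_i / μ_i)`. -/
def setGap : ℝ≥0∞ :=
  ⨆ i, ⨆ θ ∈ Θ i, Metric.hausdorffEDist (G.X θ) ((mass Γ Θ i)⁻¹ • Γ.X i)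

/-- `λ̄ = max_i sup_{(x,Y) ∈ 𝓜²} sup_{g ∈ ∂₁ f̂_i (μ_i x, Y - μ_i x)} d (g, ∂₁ f_i (μ_i x, Y))`. -/
def ownImpactGap (M : ℝ) : ℝ≥0∞ :=
  ⨆ i, ⨆ x ∈ box T M, ⨆ Y ∈ box T M,
    ⨆ g ∈ Γ.subHat i (mass Γ Θ i • x) (Y - mass Γ Θ i • x),
      Metric.infEDist g (Γ.sub i (mass Γ Θ i • x) Y)

/-- `δ̄ = max_i sup_{θ ∈ Θ_i} sup_{(x,Y) ∈ 𝓜²} d_H (∂₁ f_i (μ_i x, Y), ∂₁ f_θ (x, Y))`. -/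
def subGap (M : ℝ) : ℝ≥0∞ :=
  ⨆ i, ⨆ θ ∈ Θ i, ⨆ x ∈ box T M, ⨆ Y ∈ box T M,
    Metric.hausdorffEDist (Γ.sub i (mass Γ Θ i • x) Y) (G.sub θ x Y)

/-- The lift `ψ`: every nonatomic player in `Θ_i` plays `x_i / μ_i`. -/
def lift (x : Fin Γ.I → E T) (θ : ℝ) : E T :=
  ∑ i, (Θ i).indicator (fun _ => (mass Γ Θ i)⁻¹ • x i) θ

end Approx

/-- `Γ 0, Γ 1, …` is an atomic approximating sequence for `G` (conditions not involving aggregative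
constraints), with the cells `Θ ν i`. The null cell is `[0,1] \ ⋃ i, Θ ν i`. -/
structure IsAAS {T : ℕ} (G : NonatomicGame T) (M : ℝ) (Γ : ℕ → FiniteGame T)
    (Θ : ∀ ν, Fin (Γ ν).I → Set ℝ) : Prop where
  standing : ∀ ν, (Γ ν).Standing
  -- partition
  cell_subset : ∀ ν i, Θ ν i ⊆ Icc 0 1
  cell_measurable : ∀ ν i, NullMeasurableSet (Θ ν i) volume
  cell_disjoint : ∀ ν, Pairwise (Function.onFun Disjoint (Θ ν))
  cell_pos : ∀ ν i, 0 < volume (Θ ν i)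
  cell_cover : ∀ ν, volume (Icc (0 : ℝ) 1 \ ⋃ i, Θ ν i) = 0
  -- finite actions are nonnegative, and the costs are defined on `μ_i 𝓜 × 𝓜`
  nonneg : ∀ ν i, ∀ x ∈ (Γ ν).X i, ∀ t, 0 ≤ x t
  dom_box : ∀ ν i, ∀ x ∈ box T M, ∀ Y ∈ box T M,
    (mass (Γ ν) (Θ ν) i • x, Y) ∈ (Γ ν).dom i
  -- convergence
  span_eq : ∀ ν i, ∀ θ ∈ Θ ν i, Submodule.span ℝ ((Γ ν).X i) = Submodule.span ℝ (G.X θ)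
  setGap_tendsto : Tendsto (fun ν => setGap G (Γ ν) (Θ ν)) atTop (𝓝 0)
  ownImpactGap_tendsto : Tendsto (fun ν => ownImpactGap (Γ ν) (Θ ν) M) atTop (𝓝 0)
  subGap_tendsto : Tendsto (fun ν => subGap G (Γ ν) (Θ ν) M) atTop (𝓝 0)

/-- The aggregative constraint sets `A' ν` of the finite games `Γ ν` approximate `A`. -/
structure IsConstraintApprox {T : ℕ} (A : Set (E T)) (Γ : ℕ → FiniteGame T)
    (A' : ℕ → Set (E T)) : Prop where
  convex : ∀ ν, Convex ℝ (A' ν)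
  compact : ∀ ν, IsCompact (A' ν)
  feasible : ∀ ν, ((Γ ν).profiles (A' ν)).Nonempty
  span_eq : ∀ ν, Submodule.span ℝ (A' ν) = Submodule.span ℝ A
  tendsto : Tendsto (fun ν => Metric.hausdorffEDist (A' ν) A) atTop (𝓝 0)

end AggGame

end

open AggGame

noncomputable section

namespace AggGame

/-! ### Nearest points -/

/-! Let u be a VWE with certificate q, let x be a VNE of one finite game with certificates g_i, and
let ℓ be the lift of x. If k is a subgradient selection in H(ℓ), strong monotonicity bounds the
squared distance, up to the modulus, by the pairing ∫⟨k - q, ℓ - u⟩, so it suffices to show that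
this pairing is small.

Three facts make it small. First, k can be chosen within λ̄ + δ̄ (up to arbitrary slack) of the step
function γ equal to g_i on Θ_i (`exists_subgradient_near`). Second, ℓ is close to some y feasible
for G(A), and the VWE inequality tested at y controls -∫⟨q, ℓ - u⟩. Third, the cell integrals of u
are close to some z feasible for the finite game, and the VNE inequality tested at z controls ∫⟨γ, ℓ
- u⟩, which depends on u only through those integrals. `integral_inner_le` adds up the errors.

Without constraints, y is a pointwise projection of ℓ, and z comes from projecting the cell averages
of u. With constraints, the aggregate of such a profile misses the target set by at most twice the
gap. The Slater point Z repairs this: mixing in a weight proportional to the gap of a profile whose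
aggregate is near Z brings the aggregate back into the constraint set (`exists_combination_mem`,
`exists_feasible_approximation`). The relative balls around Z survive in the approximating sets
because the spans agree.

Measurability of the projected selections comes from the approximating sequence itself: the
correspondences are Hausdorff limits of step correspondences, and nearest points of closed convex
sets depend continuously on the set (`tendsto_nearest`). -/

open Classical in
/-- A point of `S` at minimal distance from `c`, and `0` if there is none. -/
def nearest {T : ℕ} (S : Set (E T)) (c : E T) : E T :=
  if h : ∃ p ∈ S, Metric.infDist c S = dist c p then h.choose else 0

lemma nearest_spec {T : ℕ} {S : Set (E T)} (hc : IsClosed S) (hne : S.Nonempty) (c : E T) :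
    nearest S c ∈ S ∧ Metric.infDist c S = dist c (nearest S c) := by
  have h := hc.exists_infDist_eq_dist hne c
  rw [nearest, dif_pos h]
  exact h.choose_spec

/-- By the parallelogram law: the midpoint of p and q lies in S, so it is no closer to c than p is.
This quantifies uniqueness of the nearest point and gives its stability. -/
lemma dist_sq_le_of_nearest {T : ℕ} {S : Set (E T)} (hS : Convex ℝ S) {c p q : E T} (hp : p ∈ S)
    (hq : q ∈ S) (h : Metric.infDist c S = dist c p) :
    dist p q ^ 2 ≤ 2 * (dist c q ^ 2 - dist c p ^ 2) := by
  have hm : (1 / 2 : ℝ) • p + (1 / 2 : ℝ) • q ∈ S := hS hp hq (by norm_num) (by norm_num) (by norm_num)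
  have h1 : dist c p ≤ dist c ((1 / 2 : ℝ) • p + (1 / 2 : ℝ) • q) :=
    h ▸ Metric.infDist_le_dist_of_mem hm
  have h2 := parallelogram_law_with_norm ℝ (c - p) (c - q)
  have e1 : c - p + (c - q) = (2 : ℝ) • (c - ((1 / 2 : ℝ) • p + (1 / 2 : ℝ) • q)) := by
    module
  have e2 : c - p - (c - q) = -(p - q) := by abel
  rw [e1, e2, norm_neg, norm_smul, Real.norm_eq_abs, abs_of_pos (by norm_num : (0 : ℝ) < 2)] at h2
  simp only [dist_eq_norm] at *
  have h3 := mul_self_le_mul_self (norm_nonneg _) h1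
  nlinarith

/-- A nearest point of `R n` is close to a point of S that almost minimises the distance to c, and
by `dist_sq_le_of_nearest` almost minimisers are close to the minimiser. Only the limit set has to
be convex. -/
lemma tendsto_nearest {T : ℕ} {S : Set (E T)} (hc : IsClosed S) (hne : S.Nonempty)
    (hS : Convex ℝ S) {R : ℕ → Set (E T)} (hR : ∀ n, IsClosed (R n))
    (h : Tendsto (fun n => Metric.hausdorffEDist (R n) S) atTop (𝓝 0)) (c : E T) :
    Tendsto (fun n => nearest (R n) c) atTop (𝓝 (nearest S c)) := by
  rw [Metric.tendsto_nhds]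
  intro ε hε
  obtain ⟨hp, hpd⟩ := nearest_spec hc hne c
  set p := nearest S c
  set r := dist c p with hr
  have hr0 : 0 ≤ r := dist_nonneg
  obtain ⟨δ, hδ, hδ1, hδ2, hδ3⟩ :
      ∃ δ : ℝ, 0 < δ ∧ δ ≤ 1 ∧ δ ≤ ε / 4 ∧ 8 * δ * (r + 1) ≤ ε ^ 2 / 4 := by
    refine ⟨min (min 1 (ε / 4)) (ε ^ 2 / (32 * (r + 1))), by positivity,
      (min_le_left _ _).trans (min_le_left _ _), (min_le_left _ _).trans (min_le_right _ _), ?_⟩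
    have := min_le_right (min 1 (ε / 4)) (ε ^ 2 / (32 * (r + 1)))
    calc _ ≤ 8 * (ε ^ 2 / (32 * (r + 1))) * (r + 1) := by gcongr
      _ = ε ^ 2 / 4 := by field_simp; ring
  have hev := h.eventually (gt_mem_nhds (ENNReal.ofReal_pos.2 hδ))
  filter_upwards [hev] with n hn
  -- This also shows that `R n` is nonempty, so the default value of `nearest` plays no role for
  -- such n.
  obtain ⟨p', hp', hpp'⟩ := Metric.exists_edist_lt_of_hausdorffEDist_lt hp
    (by rwa [Metric.hausdorffEDist_comm] at hn)
  obtain ⟨hq, hqd⟩ := nearest_spec (hR n) ⟨p', hp'⟩ c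
  set q := nearest (R n) c
  obtain ⟨q', hq', hqq'⟩ := Metric.exists_edist_lt_of_hausdorffEDist_lt hq hn
  rw [edist_lt_ofReal] at hpp' hqq'
  have h1 : dist c q ≤ dist c p' := hqd ▸ Metric.infDist_le_dist_of_mem hp'
  have h2 : dist c q' ≤ r + 2 * δ := by
    have := dist_triangle c p p'
    have := dist_triangle c q q'
    linarith
  have h3 := dist_sq_le_of_nearest hS hp hq' hpd
  have h4 : dist c q' ^ 2 ≤ (r + 2 * δ) ^ 2 := by gcongr
  have h5 : dist p q' ≤ ε / 2 := by
    apply abs_le_of_sq_le_sq' _ (by positivity) |>.2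
    nlinarith
  have := dist_triangle q q' p
  rw [dist_comm q' p] at this
  linarith

/-! ### Relative interiors -/

/-- A point of C off the frontier taken inside the span is interior to C relative to the span. -/
lemma exists_ball_of_notMem_rbd {T : ℕ} {C : Set (E T)} {z : E T} (hz : z ∈ C) (hz' : z ∉ rbd C) :
    ∃ t > 0, ∀ v ∈ Submodule.span ℝ C, ‖v‖ ≤ t → z + v ∈ C := by
  let z' : Submodule.span ℝ C := ⟨z, Submodule.subset_span hz⟩
  let P : Set (Submodule.span ℝ C) := (fun v : Submodule.span ℝ C => (v : E T)) ⁻¹' C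
  have h1 : z' ∉ frontier P := fun h => hz' ⟨z', h, rfl⟩
  have h2 : z' ∈ interior P := by
    by_contra h
    exact h1 ⟨subset_closure hz, h⟩
  rw [mem_interior_iff_mem_nhds, Metric.mem_nhds_iff] at h2
  obtain ⟨t, ht, hb⟩ := h2
  refine ⟨t / 2, by positivity, fun v hv hvt => ?_⟩
  have : z' + ⟨v, hv⟩ ∈ P := by
    apply hb
    rw [Metric.mem_ball, dist_eq_norm, add_sub_cancel_left]
    change ‖v‖ < t
    linarith
  exact this

/-- Otherwise the segment from x to x + v, being connected, would cross the relative boundary at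
distance at most ‖v‖ ≤ η from x. -/
lemma add_mem_of_lt_infEDist_rbd {T : ℕ} {C : Set (E T)} {x : E T} (hx : x ∈ C) {η : ℝ}
    (h : ENNReal.ofReal η < Metric.infEDist x (rbd C)) {v : E T} (hv : v ∈ Submodule.span ℝ C)
    (hvη : ‖v‖ ≤ η) : x + v ∈ C := by
  by_contra hn
  let x' : Submodule.span ℝ C := ⟨x, Submodule.subset_span hx⟩
  let v' : Submodule.span ℝ C := ⟨v, hv⟩
  let P : Set (Submodule.span ℝ C) := (fun v : Submodule.span ℝ C => (v : E T)) ⁻¹' C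
  have hcon : IsPreconnected (segment ℝ x' (x' + v')) := (convex_segment _ _).isPreconnected
  have hfr : (segment ℝ x' (x' + v') ∩ frontier P).Nonempty := by
    by_contra hemp
    rw [Set.not_nonempty_iff_eq_empty] at hemp
    have := hcon.subset_or_subset (isOpen_interior (s := P)) (isOpen_interior (s := Pᶜ))
      (by
        rw [Set.disjoint_left]
        exact fun y h1 h2 => interior_subset h2 (interior_subset h1)) ?_
    · rcases this with h1 | h1
      · exact hn (interior_subset (h1 (right_mem_segment ℝ _ _)) : x' + v' ∈ P)
      · exact interior_subset (h1 (left_mem_segment ℝ _ _)) hx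
    · intro y hy
      by_contra hy'
      rw [Set.mem_union, not_or, interior_compl, Set.mem_compl_iff, not_not] at hy'
      exact (Set.eq_empty_iff_forall_notMem.1 hemp y) ⟨hy, hy'.2, hy'.1⟩
  obtain ⟨y, hy, hyf⟩ := hfr
  have h1 : Metric.infEDist x (rbd C) ≤ edist x (y : E T) :=
    Metric.infEDist_le_edist_of_mem ⟨y, hyf, rfl⟩
  have h2 : edist x (y : E T) ≤ ENNReal.ofReal η := by
    rw [edist_le_ofReal ((norm_nonneg _).trans hvη)]
    rw [segment_eq_image'] at hy
    obtain ⟨s, hs, rfl⟩ := hy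
    rw [dist_comm, dist_eq_norm]
    have : ((x' + s • (x' + v' - x') : Submodule.span ℝ C) : E T) - x = s • v := by
      simp [x', v']
    rw [this, norm_smul, Real.norm_eq_abs, abs_of_nonneg hs.1]
    exact (mul_le_of_le_one_left (norm_nonneg _) hs.2).trans hvη
  exact absurd (h.trans_le (h1.trans h2)) (lt_irrefl _)

/-- If the relative ball of radius `t` lies within `D` of a closed convex set, then the ball of
radius `t - D` lies in that set. -/
lemma add_mem_of_ball_near {T : ℕ} {S : Set (E T)} (hc : IsClosed S) (hS : Convex ℝ S)
    {U : Submodule ℝ (E T)} (hSU : ∀ q ∈ S, q ∈ U) {z : E T} (hz : z ∈ U) {t D : ℝ} (hD : 0 ≤ D)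
    (h : ∀ u ∈ U, ‖u‖ ≤ t → ∃ q ∈ S, dist (z + u) q ≤ D) {u : E T} (hu : u ∈ U)
    (hut : ‖u‖ ≤ t - D) : z + u ∈ S := by
  have hne : S.Nonempty := by
    obtain ⟨q, hq, -⟩ := h u hu (by linarith)
    exact ⟨q, hq⟩
  obtain ⟨q, hq, hmin⟩ := exists_norm_eq_iInf_of_complete_convex hne hc.isComplete hS (z + u)
  rw [norm_eq_iInf_iff_real_inner_le_zero hS hq] at hmin
  by_contra hn
  have hne0 : z + u - q ≠ 0 := fun h0 => hn (by rwa [sub_eq_zero.1 h0])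
  set n := z + u - q with hn'
  have hr : 0 < ‖n‖ := norm_pos_iff.2 hne0
  have hnU : n ∈ U := U.sub_mem (U.add_mem hz hu) (hSU q hq)
  -- Moving a further D away from S along the outward normal n gives a point at distance ‖n‖ + D
  -- from S, which the hypothesis puts within D of S.
  obtain ⟨w, hw, hwd⟩ := h (u + (D / ‖n‖) • n) (U.add_mem hu (U.smul_mem _ hnU)) (by
    refine (norm_add_le _ _).trans ?_
    rw [norm_smul, Real.norm_eq_abs, abs_of_nonneg (by positivity), div_mul_cancel₀ _ hr.ne']
    linarith)
  have h1 : inner ℝ n (z + (u + (D / ‖n‖) • n) - w) ≤ ‖n‖ * D :=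
    (real_inner_le_norm _ _).trans (by gcongr; rwa [← dist_eq_norm])
  have h2 : z + (u + (D / ‖n‖) • n) - w = n + (D / ‖n‖) • n - (w - q) := by
    rw [hn']; abel
  rw [h2, inner_sub_right, inner_add_right, inner_smul_right, real_inner_self_eq_norm_sq] at h1
  have h3 := hmin w hw
  have h4 : D / ‖n‖ * ‖n‖ ^ 2 = ‖n‖ * D := by field_simp
  nlinarith [sq_nonneg ‖n‖, pow_pos hr 2]

/-- Vectors of `U + V` decompose with components of comparable norm. -/
lemma exists_bounded_decomposition {T : ℕ} (U V : Submodule ℝ (E T)) :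
    ∃ κ > 0, ∀ u ∈ U, ∀ v ∈ V, ∃ u' ∈ U, ∃ v' ∈ V,
      u' + v' = u + v ∧ ‖u'‖ ≤ κ * ‖u + v‖ ∧ ‖v'‖ ≤ κ * ‖u + v‖ := by
  let F : (U × V) →ₗ[ℝ] E T := U.subtype.coprod V.subtype
  -- A linear section of (u, v) ↦ u + v on its range is bounded because the dimension is finite.
  obtain ⟨g, hg⟩ := F.rangeRestrict.exists_rightInverse_of_surjective F.range_rangeRestrict
  refine ⟨‖LinearMap.toContinuousLinearMap g‖ + 1, by positivity, fun u hu v hv => ?_⟩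
  let y : F.range := F.rangeRestrict (⟨u, hu⟩, ⟨v, hv⟩)
  have hy : (y : E T) = u + v := rfl
  have hgy : F.rangeRestrict (g y) = y := LinearMap.congr_fun hg y
  have hb : ‖g y‖ ≤ (‖LinearMap.toContinuousLinearMap g‖ + 1) * ‖u + v‖ := by
    have := (LinearMap.toContinuousLinearMap g).le_opNorm y
    refine this.trans ?_
    rw [← hy]
    change _ ≤ _ * ‖y‖
    gcongr
    linarith
  refine ⟨(g y).1, (g y).1.2, (g y).2, (g y).2.2, ?_, ?_, ?_⟩
  · rw [← hy]
    exact congrArg Subtype.val hgy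
  · exact (norm_fst_le (g y)).trans hb
  · exact (norm_snd_le (g y)).trans hb

/-- Moving `b ∈ C` towards a relative interior point so as to reach `A`. -/
lemma exists_combination_mem {T : ℕ} {A C : Set (E T)} (hA : Convex ℝ A) {U V : Submodule ℝ (E T)}
    {κ : ℝ} (hκ : 0 < κ)
    (hdec : ∀ u ∈ U, ∀ v ∈ V, ∃ u' ∈ U, ∃ v' ∈ V,
      u' + v' = u + v ∧ ‖u'‖ ≤ κ * ‖u + v‖ ∧ ‖v'‖ ≤ κ * ‖u + v‖)
    {z : E T} {t : ℝ} (ht : 0 < t) (hzA : ∀ u ∈ U, ‖u‖ ≤ t → z + u ∈ A)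
    (hzC : ∀ v ∈ V, ‖v‖ ≤ t → z + v ∈ C) {a b : E T} (haA : a ∈ A) (ha : a ∈ U) (hb : b ∈ V)
    {e : ℝ} (he : 0 < e) (hab : ‖a - b‖ ≤ e) (hs : κ * e / t ≤ 1) :
    ∃ w ∈ C, (1 - κ * e / t) • b + (κ * e / t) • w ∈ A := by
  obtain ⟨u, hu, v, hv, huv, hun, hvn⟩ := hdec a ha (-b) (V.neg_mem hb)
  rw [← sub_eq_add_neg] at huv hun hvn
  set s := κ * e / t with hs'
  have hs0 : 0 < s := by positivity
  have hst : s * t = κ * e := by rw [hs']; field_simp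
  have key : ∀ y : E T, ‖y‖ ≤ κ * ‖a - b‖ → ‖((1 - s) / s) • y‖ ≤ t := by
    intro y hy
    rw [norm_smul, Real.norm_eq_abs, abs_of_nonneg (div_nonneg (by linarith) hs0.le),
      div_mul_eq_mul_div, div_le_iff₀ hs0]
    have : ‖y‖ ≤ κ * e := hy.trans (by gcongr)
    nlinarith [norm_nonneg y]
  -- With a - b = u + v, the combination (1 - s)b + sw equals (1 - s)a + s(z - ((1 - s)/s)u), a
  -- mixture of two points of A. The value s = κe/t keeps both displacements of z within t.
  refine ⟨z + ((1 - s) / s) • v, hzC _ (V.smul_mem _ hv) (key v hvn), ?_⟩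
  have hA' : z + (-((1 - s) / s)) • u ∈ A :=
    hzA _ (U.smul_mem _ hu) (by rw [neg_smul, norm_neg]; exact key u hun)
  have := hA haA hA' (sub_nonneg.2 hs) hs0.le (by ring)
  convert this using 1
  have e1 : a = b + (u + v) := by rw [huv]; abel
  have e2 : ∀ y : E T, s • ((1 - s) / s) • y = (1 - s) • y := by
    intro y; rw [smul_smul]; congr 1; field_simp
  rw [smul_add, smul_add, neg_smul, smul_neg, e2, e2, e1]
  module

/-! ### Cell partitions of the player space -/

instance : IsProbabilityMeasure leb := ⟨by simp [leb]⟩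

lemma integrable_inner_of_memLp {T : ℕ} {f g : ℝ → E T} (hf : MemLp f 2 leb) (hg : MemLp g 2 leb) :
    Integrable (fun θ => (inner ℝ (f θ) (g θ) : ℝ)) leb := by
  refine (hf.norm.integrable_mul hg.norm).mono' (hf.1.inner hg.1)
    (Eventually.of_forall fun θ => ?_)
  exact norm_inner_le_norm _ _

/-- A finite partition of `[0,1]`, up to a null set, into measurable cells of positive measure. -/
structure IsCellPartition {n : ℕ} (Θ : Fin n → Set ℝ) : Prop where
  nullMeasurable : ∀ i, NullMeasurableSet (Θ i) leb
  disjoint : Pairwise (Function.onFun Disjoint Θ)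
  pos : ∀ i, 0 < leb.real (Θ i)
  cover : ∀ᵐ θ ∂leb, ∃ i, θ ∈ Θ i

/-- The function equal to `v i` on the cell `Θ i`. -/
def glue {T n : ℕ} (Θ : Fin n → Set ℝ) (v : Fin n → ℝ → E T) (θ : ℝ) : E T :=
  ∑ i, (Θ i).indicator (v i) θ

namespace IsCellPartition

variable {T n : ℕ} {Θ : Fin n → Set ℝ}

lemma glue_eq (h : IsCellPartition Θ) (v : Fin n → ℝ → E T) {i : Fin n} {θ : ℝ} (hθ : θ ∈ Θ i) :
    glue Θ v θ = v i θ := by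
  rw [glue, Finset.sum_eq_single i, indicator_of_mem hθ]
  · intro j _ hj
    exact indicator_of_notMem (fun h' => disjoint_left.1 (h.disjoint hj) h' hθ) _
  · simp

lemma aestronglyMeasurable_glue (h : IsCellPartition Θ) {v : Fin n → ℝ → E T}
    (hv : ∀ i, AEStronglyMeasurable (v i) (leb.restrict (Θ i))) :
    AEStronglyMeasurable (glue Θ v) leb :=
  Finset.aestronglyMeasurable_fun_sum _ fun i _ =>
    (aestronglyMeasurable_indicator_iff₀ (h.nullMeasurable i)).2 (hv i)

lemma integral_eq_sum {F : Type*} [NormedAddCommGroup F] [NormedSpace ℝ F]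
    (h : IsCellPartition Θ) {f : ℝ → F} (hf : Integrable f leb) :
    ∫ θ, f θ ∂leb = ∑ i, ∫ θ in Θ i, f θ ∂leb := by
  have : f =ᵐ[leb] fun θ => ∑ i, (Θ i).indicator f θ := by
    filter_upwards [h.cover] with θ ⟨i, hi⟩
    rw [Finset.sum_eq_single i, indicator_of_mem hi]
    · intro j _ hj
      exact indicator_of_notMem (fun h' => disjoint_left.1 (h.disjoint hj) h' hi) _
    · simp
  rw [integral_congr_ae this, integral_finsetSum]
  · exact Finset.sum_congr rfl fun i _ => integral_indicator₀ (h.nullMeasurable i)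
  · exact fun i _ => hf.indicator₀ (h.nullMeasurable i)

lemma sum_measure (h : IsCellPartition Θ) : ∑ i, leb.real (Θ i) = 1 := by
  have := h.integral_eq_sum (integrable_const (1 : ℝ))
  simpa using this.symm

lemma setIntegral_glue_const (h : IsCellPartition Θ) (v : Fin n → E T) (i : Fin n) :
    ∫ θ in Θ i, glue Θ (fun j _ => v j) θ ∂leb = leb.real (Θ i) • v i := by
  rw [setIntegral_congr_ae₀ (g := fun _ => v i) (h.nullMeasurable i), setIntegral_const]
  exact Eventually.of_forall fun θ hθ => h.glue_eq _ hθ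

lemma memLp_glue_const (h : IsCellPartition Θ) (v : Fin n → E T) (p : ℝ≥0∞) :
    MemLp (glue Θ fun j _ => v j) p leb := by
  refine MemLp.of_bound (h.aestronglyMeasurable_glue fun i => aestronglyMeasurable_const)
    (∑ i, ‖v i‖) (Eventually.of_forall fun θ => ?_)
  refine (norm_sum_le _ _).trans (Finset.sum_le_sum fun i _ => norm_indicator_le_norm_self _ _)

lemma integral_inner_glue_const (h : IsCellPartition Θ) (v : Fin n → E T) {f : ℝ → E T}
    (hf : MemLp f 2 leb) :
    ∫ θ, inner ℝ (glue Θ (fun j _ => v j) θ) (f θ) ∂leb =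
      ∑ i, inner ℝ (v i) (∫ θ in Θ i, f θ ∂leb) := by
  rw [h.integral_eq_sum (integrable_inner_of_memLp (h.memLp_glue_const v 2) hf)]
  refine Finset.sum_congr rfl fun i _ => ?_
  rw [← integral_inner (hf.integrable (by norm_num)).integrableOn]
  refine setIntegral_congr_ae₀ (h.nullMeasurable i) (Eventually.of_forall fun θ hθ => ?_)
  rw [h.glue_eq _ hθ]

/-- Nearest-point selections of a correspondence that is a Hausdorff limit of step correspondences
are measurable. -/
lemma aestronglyMeasurable_nearest {S : ℝ → Set (E T)} {U : Set ℝ} (hU : NullMeasurableSet U leb)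
    (hS : ∀ θ ∈ U, IsClosed (S θ) ∧ (S θ).Nonempty ∧ Convex ℝ (S θ)) {N : ℕ → ℕ}
    {Ξ : ∀ ν, Fin (N ν) → Set ℝ} (hΞ : ∀ ν, IsCellPartition (Ξ ν))
    {R : ∀ ν, Fin (N ν) → Set (E T)} (hR : ∀ ν i, IsClosed (R ν i)) {e : ℕ → ℝ≥0∞}
    (he : Tendsto e atTop (𝓝 0))
    (hRS : ∀ ν i, ∀ θ ∈ Ξ ν i, Metric.hausdorffEDist (R ν i) (S θ) ≤ e ν) (c : E T) :
    AEStronglyMeasurable (fun θ => nearest (S θ) c) (leb.restrict U) := by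
  refine aestronglyMeasurable_of_tendsto_ae atTop
    (f := fun ν => glue (Ξ ν) fun i _ => nearest (R ν i) c) (fun ν => ?_) ?_
  · exact ((hΞ ν).aestronglyMeasurable_glue fun i => aestronglyMeasurable_const).restrict
  -- Countably many cell partitions cover almost every θ simultaneously, so θ has a cell at every
  -- level ν.
  · filter_upwards [ae_restrict_of_ae (ae_all_iff.2 fun ν => (hΞ ν).cover), ae_restrict_mem₀ hU]
      with θ hθ hθU
    choose i hi using hθ
    obtain ⟨h1, h2, h3⟩ := hS θ hθU
    have := tendsto_nearest h1 h2 h3 (fun ν => hR ν (i ν))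
      (tendsto_of_tendsto_of_tendsto_of_le_of_le tendsto_const_nhds he (fun _ => zero_le)
        fun ν => hRS ν (i ν) θ (hi ν)) c
    refine this.congr fun ν => ?_
    rw [(hΞ ν).glue_eq _ (hi ν)]

end IsCellPartition

/-! ### Basic facts on games -/

lemma isClosed_subdiff {T : ℕ} (C : Set (E T)) (φ : E T → ℝ) (x : E T) :
    IsClosed (subdiff C φ x) := by
  have : subdiff C φ x = ⋂ z ∈ C, {g | φ x + inner ℝ g (z - x) ≤ φ z} := by
    ext g; simp [subdiff]
  rw [this]
  exact isClosed_biInter fun z _ => isClosed_le (by fun_prop) continuous_const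

lemma convex_subdiff {T : ℕ} (C : Set (E T)) (φ : E T → ℝ) (x : E T) :
    Convex ℝ (subdiff C φ x) := by
  intro g hg h hh a b ha hb hab z hz
  rw [inner_add_left, real_inner_smul_left, real_inner_smul_left]
  have h1 := mul_le_mul_of_nonneg_left (hg z hz) ha
  have h2 := mul_le_mul_of_nonneg_left (hh z hz) hb
  obtain rfl : b = 1 - a := by linarith
  linarith

lemma convex_box (T : ℕ) (M : ℝ) : Convex ℝ (box T M) := by
  intro x hx y hy a b ha hb hab t
  obtain ⟨hx1, hx2⟩ := hx t
  obtain ⟨hy1, hy2⟩ := hy t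
  simp only [PiLp.add_apply, PiLp.smul_apply, smul_eq_mul]
  exact ⟨by positivity, by nlinarith⟩

lemma isClosed_box (T : ℕ) (M : ℝ) : IsClosed (box T M) := by
  have : box T M = ⋂ t, {x : E T | 0 ≤ x t ∧ x t ≤ M + 1} := by ext; simp [box]
  rw [this]
  refine isClosed_iInter fun t => ?_
  have hc : Continuous fun x : E T => x t := by fun_prop
  exact (isClosed_le continuous_const hc).inter (isClosed_le hc continuous_const)

/-- The unit of room between the radius M and the side M + 1 absorbs the error of rescaled finite
actions. -/
lemma mem_box_of_norm_le {T : ℕ} {M : ℝ} {x : E T} (h0 : ∀ t, 0 ≤ x t) (hx : ‖x‖ ≤ M + 1) :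
    x ∈ box T M := fun t =>
  ⟨h0 t, (le_abs_self _).trans ((PiLp.norm_apply_le x t).trans hx)⟩

lemma integral_mem_box {T : ℕ} {M : ℝ} {x : ℝ → E T} (hx : x ∈ NonatomicGame.boxProfiles T M) :
    ∫ θ, x θ ∂leb ∈ box T M :=
  (convex_box T M).integral_mem (isClosed_box T M) hx.2 (hx.1.integrable (by norm_num))

lemma ae_leb_mem : ∀ᵐ θ ∂leb, θ ∈ Icc (0 : ℝ) 1 := ae_restrict_mem measurableSet_Icc

namespace NonatomicGame.Standing

variable {T : ℕ} {G : NonatomicGame T} {M B : ℝ}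

lemma ae_norm_le (hG : G.Standing M B) {A : Set (E T)} {x : ℝ → E T} (hx : x ∈ G.profiles A) :
    ∀ᵐ θ ∂leb, ‖x θ‖ ≤ M := by
  filter_upwards [ae_leb_mem, hx.2.1] with θ h1 h2
  simpa using hG.subset_ball θ h1 h2

lemma profiles_subset_boxProfiles (hG : G.Standing M B) {A : Set (E T)} {x : ℝ → E T}
    (hx : x ∈ G.profiles A) : x ∈ boxProfiles T M := by
  refine ⟨hx.1, ?_⟩
  filter_upwards [ae_leb_mem, hx.2.1] with θ h1 h2
  exact hG.subset_box θ h1 h2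

lemma ae_norm_le_of_mem_H (hG : G.Standing M B) {x g : ℝ → E T} (hx : x ∈ boxProfiles T M)
    (hg : g ∈ G.H x) : ∀ᵐ θ ∂leb, ‖g θ‖ ≤ B := by
  filter_upwards [ae_leb_mem, hx.2, hg.2] with θ h1 h2 h3
  exact hG.sub_bounded θ h1 _ h2 _ (integral_mem_box hx) _ h3

lemma combination_mem_profiles (hG : G.Standing M B) {x y : ℝ → E T} (hx : x ∈ G.profiles univ)
    (hy : y ∈ G.profiles univ) {s : ℝ} (hs0 : 0 ≤ s) (hs1 : s ≤ 1) {A : Set (E T)}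
    (h : (1 - s) • ∫ θ, x θ ∂leb + s • ∫ θ, y θ ∂leb ∈ A) :
    (fun θ => (1 - s) • x θ + s • y θ) ∈ G.profiles A := by
  refine ⟨(hx.1.const_smul (1 - s)).add (hy.1.const_smul s), ?_, ?_⟩
  · filter_upwards [ae_leb_mem, hx.2.1, hy.2.1] with θ h1 h2 h3
    exact hG.convex θ h1 h2 h3 (sub_nonneg.2 hs1) hs0 (by ring)
  · have hxi := hx.1.integrable (by norm_num)
    have hyi := hy.1.integrable (by norm_num)
    have : ∫ θ, ((1 - s) • x θ + s • y θ) ∂leb = _ :=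
      integral_add (hxi.smul (1 - s)) (hyi.smul s)
    rw [integral_smul, integral_smul] at this
    rwa [this]

end NonatomicGame.Standing

/-! ### The aggregates of a finite game -/

namespace FiniteGame

variable {T : ℕ} (G : FiniteGame T)

/-- The set of feasible aggregate actions. -/
def aggregates : Set (E T) := {Y | ∃ x : Fin G.I → E T, (∀ i, x i ∈ G.X i) ∧ ∑ i, x i = Y}

variable {G}

lemma Standing.isClosed_aggregates (h : G.Standing) : IsClosed G.aggregates := by
  have : G.aggregates = (fun x : Fin G.I → E T => ∑ i, x i) '' univ.pi G.X := by
    ext Y; simp [aggregates]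
  rw [this]
  exact ((isCompact_univ_pi h.compact).image (by fun_prop)).isClosed

lemma Standing.convex_aggregates (h : G.Standing) : Convex ℝ G.aggregates := by
  rintro _ ⟨x, hx, rfl⟩ _ ⟨y, hy, rfl⟩ a b ha hb hab
  refine ⟨fun i => a • x i + b • y i, fun i => h.convex i (hx i) (hy i) ha hb hab, ?_⟩
  rw [Finset.sum_add_distrib, Finset.smul_sum, Finset.smul_sum]

end FiniteGame

/-! ### Passing between finite and nonatomic profiles and subgradients. -/

namespace IsAAS

variable {T : ℕ} {G : NonatomicGame T} {M B : ℝ} {Γ : ℕ → FiniteGame T}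
  {Θ : ∀ ν, Fin (Γ ν).I → Set ℝ}

lemma mass_eq (h : IsAAS G M Γ Θ) (ν : ℕ) (i : Fin (Γ ν).I) :
    mass (Γ ν) (Θ ν) i = leb.real (Θ ν i) := by
  rw [mass, Measure.real, leb, Measure.restrict_apply' measurableSet_Icc,
    inter_eq_left.2 (h.cell_subset ν i)]

lemma isCellPartition (h : IsAAS G M Γ Θ) (ν : ℕ) : IsCellPartition (Θ ν) where
  nullMeasurable i := (h.cell_measurable ν i).mono_ac Measure.restrict_le_self.absolutelyContinuous
  disjoint := h.cell_disjoint ν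
  pos i := by
    rw [← h.mass_eq, mass]
    exact ENNReal.toReal_pos (h.cell_pos ν i).ne' (ne_top_of_le_ne_top
      (by simp) (measure_mono (h.cell_subset ν i)))
  cover := by
    have h0 : ∀ᵐ θ ∂(volume : Measure ℝ), θ ∉ Icc (0 : ℝ) 1 \ ⋃ i, Θ ν i :=
      measure_eq_zero_iff_ae_notMem.1 (h.cell_cover ν)
    filter_upwards [ae_leb_mem, ae_restrict_of_ae h0] with θ h1 h2
    by_contra hn
    exact h2 ⟨h1, by simpa using hn⟩

lemma mass_pos (h : IsAAS G M Γ Θ) (ν : ℕ) (i : Fin (Γ ν).I) : 0 < mass (Γ ν) (Θ ν) i :=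
  h.mass_eq ν i ▸ (h.isCellPartition ν).pos i

lemma sum_mass (h : IsAAS G M Γ Θ) (ν : ℕ) : ∑ i, mass (Γ ν) (Θ ν) i = 1 := by
  simp_rw [h.mass_eq]
  exact (h.isCellPartition ν).sum_measure

lemma cell_nonempty (h : IsAAS G M Γ Θ) (ν : ℕ) (i : Fin (Γ ν).I) : (Θ ν i).Nonempty :=
  nonempty_of_measure_ne_zero (h.cell_pos ν i).ne'

lemma lift_eq (h : IsAAS G M Γ Θ) {ν : ℕ} (x : Fin (Γ ν).I → E T) {i : Fin (Γ ν).I} {θ : ℝ}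
    (hθ : θ ∈ Θ ν i) : lift (Γ ν) (Θ ν) x θ = (mass (Γ ν) (Θ ν) i)⁻¹ • x i :=
  (h.isCellPartition ν).glue_eq (fun i _ => (mass (Γ ν) (Θ ν) i)⁻¹ • x i) hθ

lemma memLp_lift (h : IsAAS G M Γ Θ) {ν : ℕ} (x : Fin (Γ ν).I → E T) :
    MemLp (lift (Γ ν) (Θ ν) x) 2 leb :=
  (h.isCellPartition ν).memLp_glue_const (fun i => (mass (Γ ν) (Θ ν) i)⁻¹ • x i) 2

lemma setIntegral_lift (h : IsAAS G M Γ Θ) {ν : ℕ} (x : Fin (Γ ν).I → E T) (i : Fin (Γ ν).I) :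
    ∫ θ in Θ ν i, lift (Γ ν) (Θ ν) x θ ∂leb = x i := by
  have := (h.isCellPartition ν).setIntegral_glue_const
    (fun i => (mass (Γ ν) (Θ ν) i)⁻¹ • x i) i
  rw [← h.mass_eq, smul_inv_smul₀ (h.mass_pos ν i).ne'] at this
  exact this

lemma integral_lift (h : IsAAS G M Γ Θ) {ν : ℕ} (x : Fin (Γ ν).I → E T) :
    ∫ θ, lift (Γ ν) (Θ ν) x θ ∂leb = ∑ i, x i := by
  rw [(h.isCellPartition ν).integral_eq_sum ((h.memLp_lift x).integrable (by norm_num))]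
  exact Finset.sum_congr rfl fun i _ => h.setIntegral_lift x i

lemma hausdorffEDist_lt {ν : ℕ} {d : ℝ≥0∞} (hd : setGap G (Γ ν) (Θ ν) < d) {i : Fin (Γ ν).I}
    {θ : ℝ} (hθ : θ ∈ Θ ν i) :
    Metric.hausdorffEDist (G.X θ) ((mass (Γ ν) (Θ ν) i)⁻¹ • (Γ ν).X i) < d :=
  (le_iSup_of_le i (le_iSup₂ (f := fun θ _ =>
    Metric.hausdorffEDist (G.X θ) ((mass (Γ ν) (Θ ν) i)⁻¹ • (Γ ν).X i)) θ hθ)).trans_lt hd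

/-- The rescaled action is within d of some X_θ, which lies in the ball of radius M. -/
lemma norm_smul_le (h : IsAAS G M Γ Θ) (hG : G.Standing M B) {ν : ℕ} {d : ℝ}
    (hd : setGap G (Γ ν) (Θ ν) < ENNReal.ofReal d) {i : Fin (Γ ν).I} {x : E T}
    (hx : x ∈ (Γ ν).X i) : ‖(mass (Γ ν) (Θ ν) i)⁻¹ • x‖ ≤ M + d := by
  obtain ⟨θ, hθ⟩ := h.cell_nonempty ν i
  obtain ⟨y, hy, hxy⟩ := Metric.exists_edist_lt_of_hausdorffEDist_lt (smul_mem_smul_set hx)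
    (by rw [Metric.hausdorffEDist_comm]; exact hausdorffEDist_lt hd hθ)
  rw [edist_lt_ofReal, dist_eq_norm] at hxy
  have hy' : ‖y‖ ≤ M := by simpa using hG.subset_ball θ (h.cell_subset ν i hθ) hy
  have := norm_le_norm_add_norm_sub y ((mass (Γ ν) (Θ ν) i)⁻¹ • x)
  rw [norm_sub_rev] at this
  linarith

lemma smul_mem_box (h : IsAAS G M Γ Θ) (hG : G.Standing M B) {ν : ℕ} {d : ℝ} (hd1 : d ≤ 1)
    (hd : setGap G (Γ ν) (Θ ν) < ENNReal.ofReal d) {i : Fin (Γ ν).I} {x : E T}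
    (hx : x ∈ (Γ ν).X i) : (mass (Γ ν) (Θ ν) i)⁻¹ • x ∈ box T M := by
  refine mem_box_of_norm_le (fun t => ?_) ((h.norm_smul_le hG hd hx).trans (by linarith))
  rw [PiLp.smul_apply, smul_eq_mul]
  exact mul_nonneg (inv_nonneg.2 (h.mass_pos ν i).le) (h.nonneg ν i x hx t)

lemma lift_mem_boxProfiles (h : IsAAS G M Γ Θ) (hG : G.Standing M B) {ν : ℕ} {d : ℝ} (hd1 : d ≤ 1)
    (hd : setGap G (Γ ν) (Θ ν) < ENNReal.ofReal d) {x : Fin (Γ ν).I → E T}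
    (hx : ∀ i, x i ∈ (Γ ν).X i) :
    lift (Γ ν) (Θ ν) x ∈ NonatomicGame.boxProfiles T M := by
  refine ⟨h.memLp_lift x, ?_⟩
  filter_upwards [(h.isCellPartition ν).cover] with θ ⟨i, hi⟩
  rw [h.lift_eq x hi]
  exact h.smul_mem_box hG hd1 hd (hx i)

/-- Averaging a profile over the cells gives a nearly feasible profile of the finite game. -/
lemma exists_near_average (h : IsAAS G M Γ Θ) {ν : ℕ} {d : ℝ} (hd0 : 0 ≤ d)
    (hd : setGap G (Γ ν) (Θ ν) < ENNReal.ofReal d) {y : ℝ → E T} (hy : y ∈ G.profiles univ) :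
    ∃ z : Fin (Γ ν).I → E T, (∀ i, z i ∈ (Γ ν).X i) ∧
      ∀ i, ‖z i - ∫ θ in Θ ν i, y θ ∂leb‖ ≤ mass (Γ ν) (Θ ν) i * d := by
  have key : ∀ i, ∃ z ∈ (Γ ν).X i,
      ‖z - ∫ θ in Θ ν i, y θ ∂leb‖ ≤ mass (Γ ν) (Θ ν) i * d := by
    intro i
    have hm := h.mass_pos ν i
    set m := mass (Γ ν) (Θ ν) i with hm'
    have hcpt : IsCompact (m⁻¹ • (Γ ν).X i) := ((h.standing ν).compact i).smul _
    have hconv : Convex ℝ (m⁻¹ • (Γ ν).X i) := ((h.standing ν).convex i).smul _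
    -- The closed d-thickening of the rescaled action set is convex, so it contains the cell average
    -- of y as well as its values.
    have hmem : ∀ᵐ θ ∂leb.restrict (Θ ν i), y θ ∈ Metric.cthickening d (m⁻¹ • (Γ ν).X i) := by
      filter_upwards [ae_restrict_of_ae hy.2.1,
        ae_restrict_mem₀ ((h.isCellPartition ν).nullMeasurable i)] with θ h1 h2
      rw [Metric.mem_cthickening_iff]
      exact ((Metric.infEDist_le_hausdorffEDist_of_mem h1).trans_lt (hausdorffEDist_lt hd h2)).le
    have havg := (hconv.cthickening d).set_average_mem Metric.isClosed_cthickening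
      (fun h0 => ((h.isCellPartition ν).pos i).ne' (by simp [Measure.real, h0]))
      (measure_ne_top _ _) hmem (hy.1.integrable (by norm_num)).integrableOn
    rw [hcpt.cthickening_eq_biUnion_closedBall hd0] at havg
    simp only [mem_iUnion, Metric.mem_closedBall] at havg
    obtain ⟨_, ⟨z, hz, rfl⟩, hzd⟩ := havg
    refine ⟨z, hz, ?_⟩
    rw [setAverage_eq, ← h.mass_eq, ← hm', dist_comm, dist_eq_norm] at hzd
    change ‖m⁻¹ • z - _‖ ≤ d at hzd
    rw [← smul_sub, norm_smul, Real.norm_eq_abs, abs_of_pos (inv_pos.2 hm), inv_mul_le_iff₀ hm]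
      at hzd
    exact hzd
  choose z hz hzd using key
  exact ⟨z, hz, hzd⟩

/-- The lift of a feasible profile of the finite game is close to a feasible profile. -/
lemma exists_profile_near_lift (h : IsAAS G M Γ Θ) (hG : G.Standing M B) {ν : ℕ} {d : ℝ}
    (hd : setGap G (Γ ν) (Θ ν) < ENNReal.ofReal d) {x : Fin (Γ ν).I → E T}
    (hx : ∀ i, x i ∈ (Γ ν).X i) :
    ∃ y ∈ G.profiles univ, ∀ᵐ θ ∂leb, ‖lift (Γ ν) (Θ ν) x θ - y θ‖ ≤ d := by
  let c : Fin (Γ ν).I → E T := fun i => (mass (Γ ν) (Θ ν) i)⁻¹ • x i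
  let y : ℝ → E T := glue (Θ ν) fun i θ => nearest (G.X θ) (c i)
  have hcl : ∀ θ ∈ Icc (0 : ℝ) 1, IsClosed (G.X θ) := fun θ hθ => (hG.compact θ hθ).isClosed
  -- The projected points c i stay fixed at level ν, while the rescaled action sets of all levels
  -- serve as step approximations of θ ↦ X_θ.
  have hmeas : AEStronglyMeasurable y leb := by
    refine (h.isCellPartition ν).aestronglyMeasurable_glue fun i => ?_
    refine IsCellPartition.aestronglyMeasurable_nearest ((h.isCellPartition ν).nullMeasurable i)
      (fun θ hθ => ?_) h.isCellPartition
      (R := fun ν i => (mass (Γ ν) (Θ ν) i)⁻¹ • (Γ ν).X i)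
      (fun ν i => (((h.standing ν).compact i).smul _).isClosed) h.setGap_tendsto
      (fun ν i θ hθ => ?_) (c i)
    · have := h.cell_subset ν i hθ
      exact ⟨hcl θ this, hG.nonempty θ this, hG.convex θ this⟩
    · rw [Metric.hausdorffEDist_comm]
      exact le_iSup_of_le i (le_iSup₂ (f := fun θ _ =>
        Metric.hausdorffEDist (G.X θ) ((mass (Γ ν) (Θ ν) i)⁻¹ • (Γ ν).X i)) θ hθ)
  have hmem : ∀ᵐ θ ∂leb, y θ ∈ G.X θ := by
    filter_upwards [ae_leb_mem, (h.isCellPartition ν).cover] with θ hθ ⟨i, hi⟩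
    simp only [y, (h.isCellPartition ν).glue_eq _ hi]
    exact (nearest_spec (hcl θ hθ) (hG.nonempty θ hθ) _).1
  refine ⟨y, ⟨MemLp.of_bound hmeas M ?_, hmem, mem_univ _⟩, ?_⟩
  · filter_upwards [ae_leb_mem, hmem] with θ h1 h2
    simpa using hG.subset_ball θ h1 h2
  · filter_upwards [ae_leb_mem, (h.isCellPartition ν).cover] with θ hθ ⟨i, hi⟩
    rw [h.lift_eq x hi]
    simp only [y, (h.isCellPartition ν).glue_eq _ hi]
    rw [← dist_eq_norm, ← (nearest_spec (hcl θ hθ) (hG.nonempty θ hθ) _).2]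
    obtain ⟨q, hq, hqd⟩ := Metric.exists_edist_lt_of_hausdorffEDist_lt
      (smul_mem_smul_set (hx i) : c i ∈ (mass (Γ ν) (Θ ν) i)⁻¹ • (Γ ν).X i)
      (by rw [Metric.hausdorffEDist_comm]; exact hausdorffEDist_lt hd hi)
    rw [edist_lt_ofReal] at hqd
    exact (Metric.infDist_le_dist_of_mem hq).trans hqd.le

/-- Subgradients at a profile of the finite game are close to a measurable selection of
subgradients of the nonatomic game at the lifted profile. -/
lemma exists_subgradient_near (h : IsAAS G M Γ Θ) (hG : G.Standing M B) {ν : ℕ} {d l δ : ℝ}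
    (hd1 : d ≤ 1) (hd : setGap G (Γ ν) (Θ ν) < ENNReal.ofReal d)
    (hl : ownImpactGap (Γ ν) (Θ ν) M < ENNReal.ofReal l)
    (hδ : subGap G (Γ ν) (Θ ν) M < ENNReal.ofReal δ) {x : Fin (Γ ν).I → E T}
    (hx : ∀ i, x i ∈ (Γ ν).X i) {g : Fin (Γ ν).I → E T}
    (hg : ∀ i, g i ∈ (Γ ν).subHat i (x i) ((Γ ν).others x i)) :
    ∃ k ∈ G.H (lift (Γ ν) (Θ ν) x), ∀ᵐ θ ∂leb, ∀ i, θ ∈ Θ ν i → ‖k θ - g i‖ ≤ l + δ := by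
  let p : Fin (Γ ν).I → E T := fun i => (mass (Γ ν) (Θ ν) i)⁻¹ • x i
  let Y : E T := ∑ i, x i
  have hp : ∀ i, p i ∈ box T M := fun i => h.smul_mem_box hG hd1 hd (hx i)
  have hbox := h.lift_mem_boxProfiles hG hd1 hd hx
  have hYi : ∫ θ, lift (Γ ν) (Θ ν) x θ ∂leb = Y := h.integral_lift x
  have hY : Y ∈ box T M := hYi ▸ integral_mem_box hbox
  have hpx : ∀ i, mass (Γ ν) (Θ ν) i • p i = x i := fun i =>
    smul_inv_smul₀ (h.mass_pos ν i).ne' _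
  have hoth : ∀ i, Y - x i = (Γ ν).others x i := fun i => by
    rw [FiniteGame.others, sub_eq_iff_eq_add', Finset.add_sum_erase _ _ (Finset.mem_univ i)]
  have hsub : ∀ i, ∃ u ∈ (Γ ν).sub i (mass (Γ ν) (Θ ν) i • p i) Y, dist (g i) u < l := by
    intro i
    have h1 : Metric.infEDist (g i) ((Γ ν).sub i (mass (Γ ν) (Θ ν) i • p i) Y)
        < ENNReal.ofReal l := by
      refine lt_of_le_of_lt ?_ hl
      refine le_iSup_of_le i (le_iSup₂_of_le (p i) (hp i) (le_iSup₂_of_le Y hY ?_))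
      refine le_iSup₂_of_le (g i) ?_ le_rfl
      rw [hpx, hoth]
      exact hg i
    obtain ⟨u, hu, hul⟩ := Metric.infEDist_lt_iff.1 h1
    exact ⟨u, hu, edist_lt_ofReal.1 hul⟩
  choose u hu hul using hsub
  -- Stated for every level, with Y and q fixed: measurability of k uses the whole sequence of
  -- subdifferentials at a fixed point.
  have hgap : ∀ (ν : ℕ) (i : Fin (Γ ν).I), ∀ θ ∈ Θ ν i, ∀ q ∈ box T M,
      Metric.hausdorffEDist ((Γ ν).sub i (mass (Γ ν) (Θ ν) i • q) Y) (G.sub θ q Y) ≤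
        subGap G (Γ ν) (Θ ν) M := fun ν i θ hθ q hq =>
    le_iSup_of_le i (le_iSup₂_of_le θ hθ (le_iSup₂_of_le q hq (le_iSup₂_of_le Y hY le_rfl)))
  have hnear : ∀ i, ∀ θ ∈ Θ ν i, ∃ q ∈ G.sub θ (p i) Y, dist (u i) q < δ := by
    intro i θ hθ
    obtain ⟨q, hq, hqd⟩ := Metric.exists_edist_lt_of_hausdorffEDist_lt (hu i)
      ((hgap ν i θ hθ (p i) (hp i)).trans_lt hδ)
    exact ⟨q, hq, edist_lt_ofReal.1 hqd⟩
  have hne : ∀ i, ∀ θ ∈ Θ ν i, (G.sub θ (p i) Y).Nonempty := fun i θ hθ =>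
    let ⟨q, hq, _⟩ := hnear i θ hθ
    ⟨q, hq⟩
  let k : ℝ → E T := glue (Θ ν) fun i θ => nearest (G.sub θ (p i) Y) (u i)
  have hmeas : AEStronglyMeasurable k leb := by
    refine (h.isCellPartition ν).aestronglyMeasurable_glue fun i => ?_
    exact IsCellPartition.aestronglyMeasurable_nearest
      ((h.isCellPartition ν).nullMeasurable i)
      (fun θ hθ => ⟨isClosed_subdiff _ _ _, hne i θ hθ, convex_subdiff _ _ _⟩) h.isCellPartition
      (R := fun ν j => (Γ ν).sub j (mass (Γ ν) (Θ ν) j • p i) Y)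
      (fun ν i => isClosed_subdiff _ _ _) h.subGap_tendsto
      (fun ν j θ hθ => hgap ν j θ hθ (p i) (hp i)) (u i)
  have hspec : ∀ i, ∀ θ ∈ Θ ν i, k θ ∈ G.sub θ (p i) Y ∧ dist (u i) (k θ) ≤ δ := by
    intro i θ hθ
    have hk : k θ = nearest (G.sub θ (p i) Y) (u i) := (h.isCellPartition ν).glue_eq _ hθ
    obtain ⟨h1, h2⟩ := nearest_spec (isClosed_subdiff _ _ _) (hne i θ hθ) (u i)
    obtain ⟨q, hq, hqd⟩ := hnear i θ hθ
    rw [hk]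
    exact ⟨h1, h2 ▸ (Metric.infDist_le_dist_of_mem hq).trans hqd.le⟩
  refine ⟨k, ⟨MemLp.of_bound hmeas B ?_, ?_⟩, Eventually.of_forall fun θ i hθ => ?_⟩
  · filter_upwards [ae_leb_mem, (h.isCellPartition ν).cover] with θ hθ ⟨i, hi⟩
    exact hG.sub_bounded θ hθ _ (hp i) _ hY _ (hspec i θ hi).1
  · filter_upwards [(h.isCellPartition ν).cover] with θ ⟨i, hi⟩
    rw [h.lift_eq x hi, hYi]
    exact (hspec i θ hi).1
  · rw [← dist_eq_norm]
    have := dist_triangle (k θ) (u i) (g i)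
    have h1 := (hspec i θ hθ).2
    rw [dist_comm] at h1
    have h2 := hul i
    rw [dist_comm] at h2
    linarith

end IsAAS

/-! ### Norms and spans of the finite action sets. -/

namespace IsAAS

variable {T : ℕ} {G : NonatomicGame T} {M B : ℝ} {Γ : ℕ → FiniteGame T}
  {Θ : ∀ ν, Fin (Γ ν).I → Set ℝ}

lemma norm_le (h : IsAAS G M Γ Θ) (hG : G.Standing M B) {ν : ℕ} {d : ℝ} (hd1 : d ≤ 1)
    (hd : setGap G (Γ ν) (Θ ν) < ENNReal.ofReal d) {i : Fin (Γ ν).I} {x : E T}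
    (hx : x ∈ (Γ ν).X i) : ‖x‖ ≤ mass (Γ ν) (Θ ν) i * (M + 1) := by
  have := h.norm_smul_le hG hd hx
  have hm := h.mass_pos ν i
  rw [norm_smul, Real.norm_eq_abs, abs_of_pos (inv_pos.2 hm), inv_mul_le_iff₀ hm] at this
  exact this.trans (by gcongr)

/-- The action sets of the finite games lie in the span of the nonatomic aggregates. -/
lemma mem_span_aggregates (h : IsAAS G M Γ Θ) (hG : G.Standing M B) {ν : ℕ} {i : Fin (Γ ν).I}
    {x : E T} (hx : x ∈ (Γ ν).X i) : x ∈ Submodule.span ℝ G.aggregates := by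
  obtain ⟨η, hη, b, hb, hbη⟩ := hG.interior_profile
  set s : ℝ := η / (‖x‖ + 1) with hs
  have hs0 : 0 < s := by positivity
  have hsx : ‖s • x‖ ≤ η := by
    rw [norm_smul, Real.norm_eq_abs, abs_of_pos hs0, hs, div_mul_eq_mul_div,
      div_le_iff₀ (by positivity)]
    nlinarith [norm_nonneg x]
  have hnm := (h.isCellPartition ν).nullMeasurable i
  have hind : MemLp ((Θ ν i).indicator fun _ => s • x) 2 leb :=
    MemLp.of_bound (aestronglyMeasurable_const.indicator₀ hnm) ‖s • x‖
      (Eventually.of_forall fun θ => norm_indicator_le_norm_self _ _)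
  -- The interior profile b leaves room to add s • x on the cell. Its aggregate then changes by a
  -- positive multiple of x, so x is in the span.
  have hmem : (b + (Θ ν i).indicator fun _ => s • x) ∈ G.profiles univ := by
    refine ⟨hb.1.add hind, ?_, mem_univ _⟩
    filter_upwards [hb.2.1, hbη] with θ h1 h2
    by_cases hθ : θ ∈ Θ ν i
    · rw [Pi.add_apply, indicator_of_mem hθ]
      refine add_mem_of_lt_infEDist_rbd h1 h2 ?_ hsx
      rw [← h.span_eq ν i θ hθ]
      exact Submodule.smul_mem _ _ (Submodule.subset_span hx)
    · rwa [Pi.add_apply, indicator_of_notMem hθ, add_zero]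
  have h1 : ∫ θ, b θ ∂leb ∈ Submodule.span ℝ G.aggregates :=
    Submodule.subset_span ⟨b, hb, rfl⟩
  have h2 : ∫ θ, (b + (Θ ν i).indicator fun _ => s • x) θ ∂leb ∈ Submodule.span ℝ G.aggregates :=
    Submodule.subset_span ⟨_, hmem, rfl⟩
  rw [integral_add' (hb.1.integrable (by norm_num)) (hind.integrable (by norm_num)),
    integral_indicator₀ hnm, setIntegral_const, ← h.mass_eq, smul_smul] at h2
  have h3 := (Submodule.add_mem_iff_right _ h1).1 h2
  exact (Submodule.smul_mem_iff _ (mul_pos (h.mass_pos ν i) hs0).ne').1 h3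

lemma norm_sum_sub_integral_le (h : IsAAS G M Γ Θ) {ν : ℕ} {d : ℝ} {y : ℝ → E T}
    (hy : y ∈ G.profiles univ) {z : Fin (Γ ν).I → E T}
    (hz : ∀ i, ‖z i - ∫ θ in Θ ν i, y θ ∂leb‖ ≤ mass (Γ ν) (Θ ν) i * d) :
    ‖∑ i, z i - ∫ θ, y θ ∂leb‖ ≤ d := by
  rw [(h.isCellPartition ν).integral_eq_sum (hy.1.integrable (by norm_num)),
    ← Finset.sum_sub_distrib]
  refine (norm_sum_le_of_le _ fun i _ => hz i).trans ?_
  rw [← Finset.sum_mul, h.sum_mass, one_mul]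

end IsAAS

/-! ### Feasible approximation under the Slater condition. -/

section

variable {T : ℕ} {G : NonatomicGame T} {M B : ℝ}

/-- Under the Slater condition, the constrained feasible sets of the finite games and of the
nonatomic game are at a distance controlled linearly by the gaps. -/
lemma exists_feasible_approximation (hG : G.Standing M B) {A : Set (E T)} (hA : Convex ℝ A)
    (hS : ∃ Z ∈ A ∩ G.aggregates, Z ∉ rbd A ∧ Z ∉ rbd G.aggregates) :
    ∃ C > 0, ∃ r > 0, ∀ (Γ : ℕ → FiniteGame T) (Θ : ∀ ν, Fin (Γ ν).I → Set ℝ)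
      (A' : ℕ → Set (E T)), IsAAS G M Γ Θ → IsConstraintApprox A Γ A' → ∀ (ν : ℕ) (d : ℝ), 0 < d →
      d < r → max (Metric.hausdorffEDist (A' ν) A) (setGap G (Γ ν) (Θ ν)) < ENNReal.ofReal d →
      (∀ x ∈ (Γ ν).profiles (A' ν), ∃ y ∈ G.profiles A,
        ∀ᵐ θ ∂leb, ‖lift (Γ ν) (Θ ν) x θ - y θ‖ ≤ C * d) ∧
      (∀ y ∈ G.profiles A, ∃ x ∈ (Γ ν).profiles (A' ν),
        ∀ i, ‖x i - ∫ θ in Θ ν i, y θ ∂leb‖ ≤ mass (Γ ν) (Θ ν) i * (C * d)) := by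
  obtain ⟨Z, ⟨hZA, hZX⟩, hZA', hZX'⟩ := hS
  obtain ⟨t₁, ht₁, hb₁⟩ := exists_ball_of_notMem_rbd hZA hZA'
  obtain ⟨t₂, ht₂, hb₂⟩ := exists_ball_of_notMem_rbd hZX hZX'
  obtain ⟨κ, hκ, hdec⟩ :=
    exists_bounded_decomposition (Submodule.span ℝ A) (Submodule.span ℝ G.aggregates)
  have hM := hG.M_pos
  obtain ⟨t, ht, htt₁, htt₂⟩ : ∃ t > 0, t ≤ t₁ ∧ t ≤ t₂ :=
    ⟨min t₁ t₂, lt_min ht₁ ht₂, min_le_left _ _, min_le_right _ _⟩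
  -- The error is d from projecting or averaging plus s(2M + 2) from mixing with weight s = 4κd/t.
  -- The bounds on d give s ≤ 1, rescaled actions of norm at most M + 1, and relative balls of
  -- radius t - d ≥ t/2 in the approximating sets.
  refine ⟨1 + (2 * M + 2) * (4 * κ / t), by positivity, min (min (t / 2) (t / (4 * κ))) 1,
    by positivity, fun Γ Θ A' h hc ν d hd0 hdr hd => ?_⟩
  obtain ⟨hdA, hd⟩ := max_lt_iff.1 hd
  have hd1 : d ≤ 1 := hdr.le.trans (min_le_right _ _)
  have hdt : d ≤ t / 2 := hdr.le.trans ((min_le_left _ _).trans (min_le_left _ _))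
  have hdκ : d ≤ t / (4 * κ) := hdr.le.trans ((min_le_left _ _).trans (min_le_right _ _))
  obtain ⟨s, hs⟩ : ∃ s, s = κ * (2 * d) / (t / 2) := ⟨_, rfl⟩
  have hs0 : 0 ≤ s := by rw [hs]; positivity
  have hs1 : s ≤ 1 := by
    rw [hs, div_le_one (by positivity)]
    rw [le_div_iff₀ (by positivity)] at hdκ
    linarith
  have hCd : d + s * (2 * M + 2) = (1 + (2 * M + 2) * (4 * κ / t)) * d := by
    rw [hs]; field_simp; ring
  have hUA : ∀ q ∈ A' ν, q ∈ Submodule.span ℝ A := fun q hq =>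
    hc.span_eq ν ▸ Submodule.subset_span hq
  have hVX : ∀ q ∈ (Γ ν).aggregates, q ∈ Submodule.span ℝ G.aggregates := by
    rintro _ ⟨x, hx, rfl⟩
    exact Submodule.sum_mem _ fun i _ => h.mem_span_aggregates hG (hx i)
  constructor
  · rintro x ⟨hx, hxA⟩
    obtain ⟨a, ha, hxa⟩ := Metric.exists_edist_lt_of_hausdorffEDist_lt hxA hdA
    rw [edist_lt_ofReal, dist_eq_norm] at hxa
    obtain ⟨y, hy, hxy⟩ := h.exists_profile_near_lift hG hd hx
    have hYd : ‖∑ i, x i - ∫ θ, y θ ∂leb‖ ≤ d := by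
      rw [← h.integral_lift, ← integral_sub ((h.memLp_lift x).integrable (by norm_num))
        (hy.1.integrable (by norm_num))]
      simpa using norm_integral_le_of_norm_le_const hxy
    have hab : ‖a - ∫ θ, y θ ∂leb‖ ≤ 2 * d := by
      have := norm_sub_le (∑ i, x i - ∫ θ, y θ ∂leb) (∑ i, x i - a)
      rw [sub_sub_sub_cancel_left] at this
      linarith
    obtain ⟨_, ⟨w, hw, rfl⟩, hcomb⟩ := exists_combination_mem (A := A) (C := G.aggregates) hA hκ
      hdec (z := Z) (half_pos ht) (fun u hu hut => hb₁ u hu (by linarith))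
      (fun v hv hvt => hb₂ v hv (by linarith)) ha (Submodule.subset_span ha)
      (Submodule.subset_span ⟨y, hy, rfl⟩) (by positivity : 0 < 2 * d) hab (hs ▸ hs1)
    rw [← hs] at hcomb
    refine ⟨_, hG.combination_mem_profiles hy hw hs0 hs1 hcomb, ?_⟩
    filter_upwards [hxy, hG.ae_norm_le hy, hG.ae_norm_le hw] with θ h1 h2 h3
    rw [← hCd]
    have e : lift (Γ ν) (Θ ν) x θ - ((1 - s) • y θ + s • w θ) =
        (lift (Γ ν) (Θ ν) x θ - y θ) + s • (y θ - w θ) := by module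
    rw [e]
    refine (norm_add_le _ _).trans (add_le_add h1 ?_)
    rw [norm_smul, Real.norm_eq_abs, abs_of_nonneg hs0]
    have := norm_sub_le (y θ) (w θ)
    gcongr
    linarith
  · rintro y hyA
    have hy : y ∈ G.profiles univ := ⟨hyA.1, hyA.2.1, mem_univ _⟩
    obtain ⟨a, ha, hya⟩ := Metric.exists_edist_lt_of_hausdorffEDist_lt hyA.2.2
      (by rwa [Metric.hausdorffEDist_comm] at hdA)
    rw [edist_lt_ofReal, dist_eq_norm] at hya
    obtain ⟨z, hz, hzy⟩ := h.exists_near_average hd0.le hd hy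
    have hZd := h.norm_sum_sub_integral_le hy hzy
    have hab : ‖a - ∑ i, z i‖ ≤ 2 * d := by
      have := norm_add_le (∑ i, z i - ∫ θ, y θ ∂leb) (∫ θ, y θ ∂leb - a)
      rw [sub_add_sub_cancel, norm_sub_rev] at this
      linarith
    obtain ⟨_, ⟨w, hw, rfl⟩, hcomb⟩ := exists_combination_mem (A := A' ν)
      (C := (Γ ν).aggregates) (hc.convex ν) hκ hdec (z := Z) (half_pos ht)
      (fun u hu hut => add_mem_of_ball_near (t := t) (D := d) (hc.compact ν).isClosed
        (hc.convex ν) hUA (Submodule.subset_span hZA) hd0.le (fun u hu hut => by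
          obtain ⟨q, hq, hqd⟩ := Metric.exists_edist_lt_of_hausdorffEDist_lt
            (hb₁ u hu (hut.trans htt₁)) (by rwa [Metric.hausdorffEDist_comm] at hdA)
          exact ⟨q, hq, (edist_lt_ofReal.1 hqd).le⟩) hu (by linarith))
      (fun v hv hvt => add_mem_of_ball_near (t := t) (D := d) (h.standing ν).isClosed_aggregates
        (h.standing ν).convex_aggregates hVX (Submodule.subset_span hZX) hd0.le
        (fun v hv hvt => by
          obtain ⟨y', hy', hyv⟩ := hb₂ v hv (hvt.trans htt₂)
          obtain ⟨z', hz', hzy'⟩ := h.exists_near_average hd0.le hd hy'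
          refine ⟨_, ⟨z', hz', rfl⟩, ?_⟩
          rw [← hyv, dist_comm, dist_eq_norm]
          exact h.norm_sum_sub_integral_le hy' hzy') hv (by linarith))
      ha (hUA a ha) (hVX _ ⟨z, hz, rfl⟩) (by positivity : 0 < 2 * d) hab (hs ▸ hs1)
    rw [← hs] at hcomb
    refine ⟨fun i => (1 - s) • z i + s • w i, ⟨fun i => (h.standing ν).convex i (hz i) (hw i)
      (sub_nonneg.2 hs1) hs0 (by ring), ?_⟩, fun i => ?_⟩
    · rwa [Finset.sum_add_distrib, ← Finset.smul_sum, ← Finset.smul_sum]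
    · rw [← hCd]
      have e : (1 - s) • z i + s • w i - ∫ θ in Θ ν i, y θ ∂leb =
          (z i - ∫ θ in Θ ν i, y θ ∂leb) + s • (w i - z i) := by module
      rw [e, mul_add]
      refine (norm_add_le _ _).trans (add_le_add (hzy i) ?_)
      rw [norm_smul, Real.norm_eq_abs, abs_of_nonneg hs0, mul_left_comm]
      have h1 := norm_sub_le (w i) (z i)
      have h2 := h.norm_le hG hd1 hd (hz i)
      have h3 := h.norm_le hG hd1 hd (hw i)
      gcongr
      linarith

/-! ### The pairing estimate. -/

namespace IsAAS

variable {Γ : ℕ → FiniteGame T} {Θ : ∀ ν, Fin (Γ ν).I → Set ℝ}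

/-- The monotonicity pairing of a lifted Nash equilibrium with a Wardrop equilibrium is small. -/
lemma integral_inner_le (h : IsAAS G M Γ Θ) (hG : G.Standing M B) {ν : ℕ} {d ε c : ℝ} (hd1 : d ≤ 1)
    (hε : 0 ≤ ε) (hd : setGap G (Γ ν) (Θ ν) < ENNReal.ofReal d) {A A' : Set (E T)}
    {x : Fin (Γ ν).I → E T} (hx : x ∈ (Γ ν).profiles A') {g : Fin (Γ ν).I → E T}
    (hgx : ∀ y ∈ (Γ ν).profiles A', 0 ≤ ∑ i, inner ℝ (g i) (y i - x i))
    {u : ℝ → E T} (hu : u ∈ G.profiles A) {q : ℝ → E T} (hq : q ∈ G.H u)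
    (hqu : ∀ y ∈ G.profiles A, 0 ≤ ∫ θ, inner ℝ (q θ) (y θ - u θ) ∂leb)
    {k : ℝ → E T} (hk : k ∈ G.H (lift (Γ ν) (Θ ν) x))
    (hkg : ∀ᵐ θ ∂leb, ∀ i, θ ∈ Θ ν i → ‖k θ - g i‖ ≤ ε)
    {y : ℝ → E T} (hy : y ∈ G.profiles A)
    (hxy : ∀ᵐ θ ∂leb, ‖lift (Γ ν) (Θ ν) x θ - y θ‖ ≤ c)
    {z : Fin (Γ ν).I → E T} (hz : z ∈ (Γ ν).profiles A')
    (hzu : ∀ i, ‖z i - ∫ θ in Θ ν i, u θ ∂leb‖ ≤ mass (Γ ν) (Θ ν) i * c) :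
    ∫ θ, inner ℝ (k θ - q θ) (lift (Γ ν) (Θ ν) x θ - u θ) ∂leb ≤
      2 * B * c + ε * (2 * M + d + c) := by
  have hP := h.isCellPartition ν
  have hbox := h.lift_mem_boxProfiles hG hd1 hd hx.1
  have hkB := hG.ae_norm_le_of_mem_H hbox hk
  have hqB := hG.ae_norm_le_of_mem_H (hG.profiles_subset_boxProfiles hu) hq
  set ℓ := lift (Γ ν) (Θ ν) x with hℓ
  have hℓ2 : MemLp ℓ 2 leb := h.memLp_lift x
  have hw : MemLp (ℓ - u) 2 leb := hℓ2.sub hu.1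
  have hγ : MemLp (glue (Θ ν) fun j _ => g j) 2 leb := hP.memLp_glue_const g 2
  -- Each g i is within ε of a value of k on a cell of positive measure, and k is bounded by B.
  have hgB : ∀ i, ‖g i‖ ≤ B + ε := by
    intro i
    have hne : (leb.restrict (Θ ν i)) ≠ 0 := by
      intro h0
      have := hP.pos i
      rw [← measureReal_restrict_apply_self, h0] at this
      simp at this
    have : (ae (leb.restrict (Θ ν i))).NeBot := ae_neBot.2 hne
    obtain ⟨θ, h1, h2, h3⟩ := ((ae_restrict_of_ae hkB).and ((ae_restrict_of_ae hkg).and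
      (ae_restrict_mem₀ (hP.nullMeasurable i)))).exists
    have := norm_le_norm_add_norm_sub (k θ) (g i)
    linarith [h2 i h3]
  have I1 : ∫ θ, inner ℝ (q θ) (y θ - ℓ θ) ∂leb ≤ B * c := by
    have := norm_integral_le_of_norm_le_const (μ := leb) (C := B * c)
      (f := fun θ => (inner ℝ (q θ) (y θ - ℓ θ) : ℝ)) (by
        filter_upwards [hqB, hxy] with θ h1 h2
        refine (norm_inner_le_norm _ _).trans ?_
        rw [norm_sub_rev] at h2
        exact mul_le_mul h1 h2 (norm_nonneg _) ((norm_nonneg _).trans h1))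
    simpa using (le_abs_self _).trans this
  have I2 : ∫ θ, inner ℝ (k θ - glue (Θ ν) (fun j _ => g j) θ) (ℓ θ - u θ) ∂leb ≤
      ε * (2 * M + d) := by
    have := norm_integral_le_of_norm_le_const (μ := leb) (C := ε * (2 * M + d))
      (f := fun θ => (inner ℝ (k θ - glue (Θ ν) (fun j _ => g j) θ) (ℓ θ - u θ) : ℝ)) (by
        filter_upwards [hkg, hP.cover, hG.ae_norm_le hu] with θ h1 ⟨i, hi⟩ h2
        refine (norm_inner_le_norm _ _).trans ?_
        rw [hP.glue_eq _ hi, hℓ, h.lift_eq x hi]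
        refine mul_le_mul (h1 i hi) ?_ (norm_nonneg _) hε
        refine (norm_sub_le _ _).trans ?_
        linarith [h.norm_smul_le hG hd (hx.1 i)])
    simpa using (le_abs_self _).trans this
  have I3 : ∫ θ, inner ℝ (glue (Θ ν) (fun j _ => g j) θ) (ℓ θ - u θ) ∂leb ≤ (B + ε) * c := by
    -- Integrating the constant g i over its cell replaces u by its cell integral, which the VNE
    -- competitor z approximates.
    have e : ∫ θ, inner ℝ (glue (Θ ν) (fun j _ => g j) θ) (ℓ θ - u θ) ∂leb =
        ∑ i, inner ℝ (g i) (z i - ∫ θ in Θ ν i, u θ ∂leb) -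
          ∑ i, inner ℝ (g i) (z i - x i) := by
      have := hP.integral_inner_glue_const g hw
      simp only [Pi.sub_apply] at this
      rw [this, ← Finset.sum_sub_distrib]
      refine Finset.sum_congr rfl fun i _ => ?_
      rw [integral_sub (hℓ2.integrable (by norm_num)).integrableOn
        (hu.1.integrable (by norm_num)).integrableOn, h.setIntegral_lift, ← inner_sub_right]
      congr 1
      abel
    have e2 : ∑ i, inner ℝ (g i) (z i - ∫ θ in Θ ν i, u θ ∂leb) ≤ (B + ε) * c := by
      calc _ ≤ ∑ i, mass (Γ ν) (Θ ν) i * ((B + ε) * c) := by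
            refine Finset.sum_le_sum fun i _ => ?_
            refine (real_inner_le_norm _ _).trans ?_
            rw [mul_left_comm]
            exact mul_le_mul (hgB i) (hzu i) (norm_nonneg _) ((norm_nonneg _).trans (hgB i))
        _ = _ := by rw [← Finset.sum_mul, h.sum_mass, one_mul]
    linarith [hgx z hz]
  have I0 := hqu y hy
  have hint : ∀ {a b : ℝ → E T}, MemLp a 2 leb → MemLp b 2 leb →
      Integrable (fun θ => (inner ℝ (a θ) (b θ) : ℝ)) leb := integrable_inner_of_memLp
  have J1 := hint (hk.1.sub hγ) hw
  have J2 := hint hγ hw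
  have J3 := hint hq.1 (hy.1.sub hℓ2)
  have J4 := hint hq.1 (hy.1.sub hu.1)
  simp only [Pi.sub_apply] at J1 J2 J3 J4
  have key : ∫ θ, inner ℝ (k θ - q θ) (ℓ θ - u θ) ∂leb =
      ∫ θ, inner ℝ (k θ - glue (Θ ν) (fun j _ => g j) θ) (ℓ θ - u θ) ∂leb +
      ∫ θ, inner ℝ (glue (Θ ν) (fun j _ => g j) θ) (ℓ θ - u θ) ∂leb +
      (∫ θ, inner ℝ (q θ) (y θ - ℓ θ) ∂leb - ∫ θ, inner ℝ (q θ) (y θ - u θ) ∂leb) := by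
    have J12 : Integrable (fun θ => (inner ℝ (k θ - glue (Θ ν) (fun j _ => g j) θ) (ℓ θ - u θ) : ℝ) +
      inner ℝ (glue (Θ ν) (fun j _ => g j) θ) (ℓ θ - u θ)) leb := J1.add J2
    have J34 : Integrable (fun θ => (inner ℝ (q θ) (y θ - ℓ θ) : ℝ) - inner ℝ (q θ) (y θ - u θ))
      leb := J3.sub J4
    rw [← integral_sub J3 J4, ← integral_add J1 J2, ← integral_add J12 J34]
    refine integral_congr_ae (Eventually.of_forall fun θ => ?_)
    simp only [inner_sub_left, inner_sub_right]
    ring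
  rw [key]
  linarith

end IsAAS

end

/-! ### Convergence -/

/-- Finiteness of f matters because `toReal` sends ∞ to 0. -/
lemma sq_le_ofReal_one_div_mul {f R : ℝ≥0∞} (hf : f ≠ ∞) {β : ℝ} (hβ : 0 < β)
    (h : ENNReal.ofReal (β * f.toReal ^ 2) ≤ R) : f ^ 2 ≤ ENNReal.ofReal (1 / β) * R := by
  refine le_trans (le_of_eq ?_) (mul_le_mul_right h _)
  rw [← ENNReal.ofReal_mul (by positivity), ← mul_assoc, one_div_mul_cancel hβ.ne', one_mul,
    ENNReal.ofReal_pow ENNReal.toReal_nonneg, ENNReal.ofReal_toReal hf]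

lemma tendsto_zero_of_sq_le {f b : ℕ → ℝ≥0∞} (h : ∀ᶠ ν in atTop, f ν ^ 2 ≤ b ν)
    (hb : Tendsto b atTop (𝓝 0)) : Tendsto f atTop (𝓝 0) := by
  rw [ENNReal.tendsto_nhds_zero] at hb ⊢
  intro ε hε
  filter_upwards [h, hb (ε ^ 2) (ENNReal.pow_pos hε 2)] with ν h1 h2
  exact le_of_not_gt fun hlt =>
    absurd (h1.trans h2) (not_le.2 (ENNReal.pow_lt_pow_left two_ne_zero hlt))

namespace IsAAS

variable {T : ℕ} {G : NonatomicGame T} {M B : ℝ} {Γ : ℕ → FiniteGame T}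
  {Θ : ∀ ν, Fin (Γ ν).I → Set ℝ}

/-- Any lower bound for the monotonicity pairing of the lifted equilibrium of `Γ ν` with a Wardrop
equilibrium is controlled by the gaps. -/
lemma ofReal_le_of_le_pairing (h : IsAAS G M Γ Θ) (hG : G.Standing M B) {A A' : Set (E T)}
    {u : ℝ → E T} (hu : G.IsVWE A u) {ν : ℕ} {x : Fin (Γ ν).I → E T} (hx : (Γ ν).IsVNE A' x)
    {D : ℝ≥0∞} (hD : setGap G (Γ ν) (Θ ν) ≤ D) {C r K : ℝ} (hC : 0 ≤ C) (hCr : C * r ≤ 1 / 2)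
    (hr : r ≤ 1 / 2) (hCK : C ≤ K) (hDr : D < ENNReal.ofReal r)
    (happrox : ∀ d : ℝ, 0 < d → d < r → D < ENNReal.ofReal d →
      (∀ x ∈ (Γ ν).profiles A', ∃ y ∈ G.profiles A,
        ∀ᵐ θ ∂leb, ‖lift (Γ ν) (Θ ν) x θ - y θ‖ ≤ C * d) ∧
      (∀ y ∈ G.profiles A, ∃ x ∈ (Γ ν).profiles A',
        ∀ i, ‖x i - ∫ θ in Θ ν i, y θ ∂leb‖ ≤ mass (Γ ν) (Θ ν) i * (C * d)))
    {V : ℝ} (hV : ∀ k ∈ G.H (lift (Γ ν) (Θ ν) x), ∀ q ∈ G.H u,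
      V ≤ ∫ θ, inner ℝ (k θ - q θ) (lift (Γ ν) (Θ ν) x θ - u θ) ∂leb) :
    ENNReal.ofReal V ≤ ENNReal.ofReal ((3 * B + 1) * K) * D +
      ENNReal.ofReal (2 * M + 1) * (subGap G (Γ ν) (Θ ν) M + ownImpactGap (Γ ν) (Θ ν) M) := by
  have hM := hG.M_pos
  have hB := hG.B_pos
  have hm : ENNReal.ofReal (2 * M + 1) ≠ 0 := (ENNReal.ofReal_pos.2 (by positivity)).ne'
  by_cases htop : subGap G (Γ ν) (Θ ν) M + ownImpactGap (Γ ν) (Θ ν) M = ∞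
  · rw [htop, ENNReal.mul_top hm, add_top]
    exact le_top
  obtain ⟨hδ, hl⟩ := ENNReal.add_ne_top.1 htop
  have hDtop : D ≠ ∞ := hDr.ne_top
  obtain ⟨g, hg, hgx⟩ := hx.2
  obtain ⟨q, hq, hqu⟩ := hu.2
  have hDr' : D.toReal < r := (ENNReal.lt_ofReal_iff_toReal_lt hDtop).1 hDr
  set D₀ := D.toReal with hD₀
  set δ₀ := (subGap G (Γ ν) (Θ ν) M).toReal with hδ₀
  set l₀ := (ownImpactGap (Γ ν) (Θ ν) M).toReal with hl₀
  have hD0 : 0 ≤ D₀ := ENNReal.toReal_nonneg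
  have hδ0 : 0 ≤ δ₀ := ENNReal.toReal_nonneg
  have hl0 : 0 ≤ l₀ := ENNReal.toReal_nonneg
  have hK : 0 ≤ K := hC.trans hCK
  -- The approximation lemmas need strict upper bounds on the gaps, so each gap gets slack ε,
  -- removed below by letting ε tend to 0.
  have hε : ∀ ε : ℝ, 0 < ε → ε < r - D₀ →
      V ≤ (3 * B + 1) * K * (D₀ + ε) + (2 * M + 1) * (δ₀ + ε + (l₀ + ε)) := by
    intro ε hε hεr
    have hlt : ∀ {a : ℝ≥0∞}, a ≠ ∞ → a < ENNReal.ofReal (a.toReal + ε) := fun ha =>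
      (ENNReal.lt_ofReal_iff_toReal_lt ha).2 (by linarith)
    obtain ⟨h1, h2⟩ := happrox (D₀ + ε) (by positivity) (by linarith) (hlt hDtop)
    obtain ⟨y, hy, hxy⟩ := h1 x hx.1
    obtain ⟨z, hz, hzu⟩ := h2 u hu.1
    have hd := hD.trans_lt (hlt hDtop)
    have hd1 : D₀ + ε ≤ 1 := by linarith
    obtain ⟨k, hk, hkg⟩ := h.exists_subgradient_near hG hd1 hd (hlt hl) (hlt hδ) hx.1.1 hg
    have hCd : C * (D₀ + ε) ≤ 1 / 2 := le_trans (by gcongr; linarith) hCr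
    have := h.integral_inner_le hG hd1 (by positivity) hd hx.1 hgx hu.1 hq hqu hk hkg hy hxy hz hzu
    refine (hV k hk q hq).trans (this.trans ?_)
    have e1 : 2 * B * (C * (D₀ + ε)) ≤ (3 * B + 1) * K * (D₀ + ε) := by
      rw [← mul_assoc]
      gcongr
      linarith
    -- Both d = D₀ + ε and Cd are at most 1/2; this is where the factor 2M + 1 comes from.
    have e2 : (l₀ + ε + (δ₀ + ε)) * (2 * M + (D₀ + ε) + C * (D₀ + ε)) ≤
        (2 * M + 1) * (δ₀ + ε + (l₀ + ε)) := by
      rw [mul_comm, add_comm (l₀ + ε)]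
      exact mul_le_mul_of_nonneg_right (by linarith) (by positivity)
    exact add_le_add e1 e2
  have hlim : Tendsto (fun ε : ℝ => (3 * B + 1) * K * (D₀ + ε) +
      (2 * M + 1) * (δ₀ + ε + (l₀ + ε))) (𝓝[>] 0)
      (𝓝 ((3 * B + 1) * K * D₀ + (2 * M + 1) * (δ₀ + l₀))) :=
    ((by fun_prop : Continuous fun ε : ℝ => (3 * B + 1) * K * (D₀ + ε) +
      (2 * M + 1) * (δ₀ + ε + (l₀ + ε))).tendsto' _ _ (by simp)).mono_left nhdsWithin_le_nhds
  have hfin := ge_of_tendsto hlim (by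
    filter_upwards [Ioo_mem_nhdsGT (sub_pos.2 hDr')] with ε hε'
    exact hε ε hε'.1 hε'.2)
  refine (ENNReal.ofReal_le_ofReal hfin).trans (le_of_eq ?_)
  rw [ENNReal.ofReal_add (by positivity) (by positivity), ENNReal.ofReal_mul (p := (3 * B + 1) * K)
    (by positivity), ENNReal.ofReal_mul (p := 2 * M + 1) (by positivity), ENNReal.ofReal_add hδ0 hl0, ENNReal.ofReal_toReal hDtop,
    ENNReal.ofReal_toReal hδ, ENNReal.ofReal_toReal hl]

/-- Convergence with rates, given feasible approximations at distance linear in `D ν`. -/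
lemma convergence (h : IsAAS G M Γ Θ) (hG : G.Standing M B) {A : Set (E T)} {A' : ℕ → Set (E T)}
    {u : ℝ → E T} (hu : G.IsVWE A u) {x : ∀ ν, Fin (Γ ν).I → E T}
    (hx : ∀ ν, (Γ ν).IsVNE (A' ν) (x ν))
    {D : ℕ → ℝ≥0∞} (hD : ∀ ν, setGap G (Γ ν) (Θ ν) ≤ D ν) (hD0 : Tendsto D atTop (𝓝 0))
    {C r K : ℝ} (hC : 0 ≤ C) (hr0 : 0 < r) (hCr : C * r ≤ 1 / 2) (hr : r ≤ 1 / 2) (hCK : C ≤ K)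
    (happrox : ∀ ν, ∀ d : ℝ, 0 < d → d < r → D ν < ENNReal.ofReal d →
      (∀ x ∈ (Γ ν).profiles (A' ν), ∃ y ∈ G.profiles A,
        ∀ᵐ θ ∂leb, ‖lift (Γ ν) (Θ ν) x θ - y θ‖ ≤ C * d) ∧
      (∀ y ∈ G.profiles A, ∃ x ∈ (Γ ν).profiles (A' ν),
        ∀ i, ‖x i - ∫ θ in Θ ν i, y θ ∂leb‖ ≤ mass (Γ ν) (Θ ν) i * (C * d))) :
    (∀ β : ℝ, 0 < β → G.AggStronglyMonotone M β →
      Tendsto (fun ν => ∑ i, x ν i) atTop (𝓝 (∫ θ, u θ ∂leb)) ∧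
      ∀ ν, D ν < ENNReal.ofReal r →
        ‖∑ i, x ν i - ∫ θ, u θ ∂leb‖ₑ ^ 2 ≤ ENNReal.ofReal (1 / β) *
          (ENNReal.ofReal ((3 * B + 1) * K) * D ν +
            ENNReal.ofReal (2 * M + 1) *
              (subGap G (Γ ν) (Θ ν) M + ownImpactGap (Γ ν) (Θ ν) M))) ∧
    (∀ α : ℝ, 0 < α → G.StronglyMonotone M α →
      Tendsto (fun ν => eLpNorm (lift (Γ ν) (Θ ν) (x ν) - u) 2 leb) atTop (𝓝 0) ∧
      ∀ ν, D ν < ENNReal.ofReal r →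
        eLpNorm (lift (Γ ν) (Θ ν) (x ν) - u) 2 leb ^ 2 ≤ ENNReal.ofReal (1 / α) *
          (ENNReal.ofReal ((3 * B + 1) * K) * D ν +
            ENNReal.ofReal (2 * M + 1) *
              (subGap G (Γ ν) (Θ ν) M + ownImpactGap (Γ ν) (Θ ν) M))) := by
  have hev : ∀ᶠ ν in atTop, D ν < ENNReal.ofReal r :=
    hD0.eventually (gt_mem_nhds (ENNReal.ofReal_pos.2 hr0))
  have hrhs : ∀ b : ℝ, Tendsto (fun ν => ENNReal.ofReal b *
      (ENNReal.ofReal ((3 * B + 1) * K) * D ν + ENNReal.ofReal (2 * M + 1) *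
        (subGap G (Γ ν) (Θ ν) M + ownImpactGap (Γ ν) (Θ ν) M))) atTop (𝓝 0) := by
    intro b
    have hmul : ∀ (c : ℝ) {f : ℕ → ℝ≥0∞}, Tendsto f atTop (𝓝 0) →
        Tendsto (fun ν => ENNReal.ofReal c * f ν) atTop (𝓝 0) := fun c f hf => by
      simpa using ENNReal.Tendsto.const_mul hf (Or.inr (ENNReal.ofReal_ne_top (r := c)))
    refine hmul b ?_
    have h1 := (hmul ((3 * B + 1) * K) hD0).add
      (hmul (2 * M + 1) (by simpa using h.subGap_tendsto.add h.ownImpactGap_tendsto))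
    simpa using h1
  have hlift : ∀ ν, D ν < ENNReal.ofReal r →
      lift (Γ ν) (Θ ν) (x ν) ∈ NonatomicGame.boxProfiles T M := fun ν hν =>
    h.lift_mem_boxProfiles hG (by linarith) ((hD ν).trans_lt hν) (hx ν).1.1
  have hubox := hG.profiles_subset_boxProfiles hu.1
  have hbound := fun ν (hν : D ν < ENNReal.ofReal r) (V : ℝ) => h.ofReal_le_of_le_pairing hG hu (hx ν)
    (hD ν) hC hCr hr hCK hν (happrox ν) (V := V)
  refine ⟨fun β hβ hmon => ?_, fun α hα hmon => ?_⟩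
  · have key : ∀ ν, D ν < ENNReal.ofReal r →
        ‖∑ i, x ν i - ∫ θ, u θ ∂leb‖ₑ ^ 2 ≤ ENNReal.ofReal (1 / β) *
          (ENNReal.ofReal ((3 * B + 1) * K) * D ν +
            ENNReal.ofReal (2 * M + 1) *
              (subGap G (Γ ν) (Θ ν) M + ownImpactGap (Γ ν) (Θ ν) M)) := fun ν hν => by
      refine sq_le_ofReal_one_div_mul enorm_ne_top hβ (hbound ν hν _ fun k hk q hq => ?_)
      rw [toReal_enorm, ← h.integral_lift]
      exact hmon _ (hlift ν hν) _ hubox k hk q hq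
    refine ⟨?_, key⟩
    rw [tendsto_iff_edist_tendsto_0]
    simp_rw [edist_eq_enorm_sub]
    exact tendsto_zero_of_sq_le (hev.mono key) (hrhs _)
  · have key : ∀ ν, D ν < ENNReal.ofReal r →
        eLpNorm (lift (Γ ν) (Θ ν) (x ν) - u) 2 leb ^ 2 ≤ ENNReal.ofReal (1 / α) *
          (ENNReal.ofReal ((3 * B + 1) * K) * D ν +
            ENNReal.ofReal (2 * M + 1) *
              (subGap G (Γ ν) (Θ ν) M + ownImpactGap (Γ ν) (Θ ν) M)) := fun ν hν =>
      sq_le_ofReal_one_div_mul ((h.memLp_lift _).sub hu.1.1).2.ne hα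
        (hbound ν hν _ fun k hk q hq => hmon _ (hlift ν hν) _ hubox k hk q hq)
    exact ⟨tendsto_zero_of_sq_le (hev.mono key) (hrhs _), key⟩

end IsAAS

end AggGame

end

/-! ### The main theorem. -/

theorem mainTheorem1 {T : ℕ} (G : NonatomicGame T) (M B : ℝ) (hG : G.Standing M B) :
    -- with aggregative constraints
    (∀ A : Set (E T), Convex ℝ A → IsCompact A →
      (∃ Z ∈ A ∩ G.aggregates, Z ∉ rbd A ∧ Z ∉ rbd G.aggregates) →
      ∃ ρ ρbar : ℝ, 0 < ρ ∧ 0 < ρbar ∧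
        ∀ (Γ : ℕ → FiniteGame T) (Θ : ∀ ν, Fin (Γ ν).I → Set ℝ) (A' : ℕ → Set (E T)),
          IsAAS G M Γ Θ → IsConstraintApprox A Γ A' →
          ∀ (xstar : ℝ → E T) (xhat : ∀ ν, Fin (Γ ν).I → E T),
            G.IsVWE A xstar → (∀ ν, (Γ ν).IsVNE (A' ν) (xhat ν)) →
            (∀ β : ℝ, 0 < β → G.AggStronglyMonotone M β →
              Tendsto (fun ν => ∑ i, xhat ν i) atTop (𝓝 (∫ θ, xstar θ ∂leb)) ∧
              ∀ ν, max (setGap G (Γ ν) (Θ ν)) (Metric.hausdorffEDist (A' ν) A)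
                  < ENNReal.ofReal (min ρbar ρ) →
                ‖∑ i, xhat ν i - ∫ θ, xstar θ ∂leb‖ₑ ^ 2 ≤
                  ENNReal.ofReal (1 / β) *
                    (ENNReal.ofReal ((3 * B + 1) * ((M + 1) / min ρ ρbar)) *
                        max (Metric.hausdorffEDist (A' ν) A) (setGap G (Γ ν) (Θ ν)) +
                      ENNReal.ofReal (2 * M + 1) *
                        (subGap G (Γ ν) (Θ ν) M + ownImpactGap (Γ ν) (Θ ν) M))) ∧
            (∀ α : ℝ, 0 < α → G.StronglyMonotone M α →
              Tendsto (fun ν => eLpNorm (lift (Γ ν) (Θ ν) (xhat ν) - xstar) 2 leb)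
                atTop (𝓝 0) ∧
              ∀ ν, max (setGap G (Γ ν) (Θ ν)) (Metric.hausdorffEDist (A' ν) A)
                  < ENNReal.ofReal (min ρbar ρ) →
                eLpNorm (lift (Γ ν) (Θ ν) (xhat ν) - xstar) 2 leb ^ 2 ≤
                  ENNReal.ofReal (1 / α) *
                    (ENNReal.ofReal ((3 * B + 1) * ((M + 1) / min ρ ρbar)) *
                        max (Metric.hausdorffEDist (A' ν) A) (setGap G (Γ ν) (Θ ν)) +
                      ENNReal.ofReal (2 * M + 1) *
                        (subGap G (Γ ν) (Θ ν) M + ownImpactGap (Γ ν) (Θ ν) M)))) ∧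
    -- without aggregative constraints
    (∃ ρ : ℝ, 0 < ρ ∧
      ∀ (Γ : ℕ → FiniteGame T) (Θ : ∀ ν, Fin (Γ ν).I → Set ℝ), IsAAS G M Γ Θ →
        ∀ (xstar : ℝ → E T) (xhat : ∀ ν, Fin (Γ ν).I → E T),
          G.IsVWE univ xstar → (∀ ν, (Γ ν).IsVNE univ (xhat ν)) →
          (∀ β : ℝ, 0 < β → G.AggStronglyMonotone M β →
            Tendsto (fun ν => ∑ i, xhat ν i) atTop (𝓝 (∫ θ, xstar θ ∂leb)) ∧
            ∀ ν, setGap G (Γ ν) (Θ ν) < ENNReal.ofReal ρ →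
              ‖∑ i, xhat ν i - ∫ θ, xstar θ ∂leb‖ₑ ^ 2 ≤
                ENNReal.ofReal (1 / β) *
                  (ENNReal.ofReal (3 * B + 1) * setGap G (Γ ν) (Θ ν) +
                    ENNReal.ofReal (2 * M + 1) *
                      (subGap G (Γ ν) (Θ ν) M + ownImpactGap (Γ ν) (Θ ν) M))) ∧
          (∀ α : ℝ, 0 < α → G.StronglyMonotone M α →
            Tendsto (fun ν => eLpNorm (lift (Γ ν) (Θ ν) (xhat ν) - xstar) 2 leb)
              atTop (𝓝 0) ∧
            ∀ ν, setGap G (Γ ν) (Θ ν) < ENNReal.ofReal ρ →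
              eLpNorm (lift (Γ ν) (Θ ν) (xhat ν) - xstar) 2 leb ^ 2 ≤
                ENNReal.ofReal (1 / α) *
                  (ENNReal.ofReal (3 * B + 1) * setGap G (Γ ν) (Θ ν) +
                    ENNReal.ofReal (2 * M + 1) *
                      (subGap G (Γ ν) (Θ ν) M + ownImpactGap (Γ ν) (Θ ν) M)))) := by 
  constructor
  · intro A hA _ hS
    obtain ⟨C, hC, r, hr, happ⟩ := exists_feasible_approximation hG hA hS
    have hM := hG.M_pos
    -- One small ρ serves for both constants: Cρ ≤ 1/2 ≤ M + 1 makes (M + 1)/ρ dominate C.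
    obtain ⟨ρ, hρ, hρr, hρ2, hCρ, hCK⟩ : ∃ ρ : ℝ, 0 < ρ ∧ ρ ≤ r ∧ ρ ≤ 1 / 2 ∧ C * ρ ≤ 1 / 2 ∧
        C ≤ (M + 1) / ρ := by
      have h1 := min_le_right (min r (1 / 2)) (1 / (2 * C))
      rw [le_div_iff₀ (by positivity)] at h1
      refine ⟨min (min r (1 / 2)) (1 / (2 * C)), by positivity,
        (min_le_left _ _).trans (min_le_left _ _), (min_le_left _ _).trans (min_le_right _ _),
        by linarith, ?_⟩
      rw [le_div_iff₀ (by positivity)]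
      linarith
    refine ⟨ρ, ρ, hρ, hρ, fun Γ Θ A' h hc xstar xhat hstar hhat => ?_⟩
    simp only [min_self]
    simp_rw [max_comm (setGap G _ _)]
    exact h.convergence hG hstar hhat
      (D := fun ν => max (Metric.hausdorffEDist (A' ν) A) (setGap G (Γ ν) (Θ ν)))
      (fun ν => le_max_right _ _) (by simpa using hc.tendsto.max h.setGap_tendsto)
      hC.le hρ hCρ hρ2 hCK fun ν d hd0 hd => happ Γ Θ A' h hc ν d hd0 (hd.trans_le hρr)
  · refine ⟨1 / 2, by norm_num, fun Γ Θ h xstar xhat hstar hhat => ?_⟩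
    -- With no aggregate to correct, projection and averaging alone give feasible profiles, so C = K
    -- = 1.
    have := h.convergence hG hstar hhat (D := fun ν => setGap G (Γ ν) (Θ ν))
      (fun ν => le_rfl) h.setGap_tendsto (C := 1) (r := 1 / 2) (K := 1) zero_le_one (by norm_num)
      (by norm_num) le_rfl le_rfl fun ν d hd0 _ hd => by
        rw [one_mul]
        refine ⟨fun x hx => h.exists_profile_near_lift hG hd hx.1, fun y hy => ?_⟩
        obtain ⟨z, hz, hzy⟩ := h.exists_near_average hd0.le hd hy
        exact ⟨z, ⟨hz, mem_univ _⟩, hzy⟩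
    simpa only [mul_one] using this
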